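/- **Theorem 1.1 (conn-exists).** Let $m\ge 1$ and let $W=W(u,v)\in C^2(\mathbb R^m\times\mathbb R^m;[0,\infty))$ satisfy: - ($\mathbf H_1$) the set $A:=\{u\in\mathbb R^m: W(u,0)=0\}$ is partitioned into two nonempty disjoint compact subsets $A^-$ and $A^+$; - ($\mathbf H_2$) $\Omega\subset\mathbb R^m$ is an open set with $A^-\subset\Omega$, $A^+\cap\overline\Omega=\emptyset$, and $W(u,v)>0$ for every $u\in\partial\Omega$ and every $v\in\mathbb R^m$; - ($\mathbf H_3$) $\liminf_{|u|\to\infty}W(u,v)>0$ uniformly in $v\in\mathbb R^m$, i.e. there are $c>0$ and $R$ with $W(u,v)\ge c$ whenever $|u|\ge R$ and $v\in\mathbb R^m$. Let $d$ be the Euclidean distance, and let $q\in\big(0,\tfrac12 d(A^-,A^+)\big)$ be such that $\{u: d(u,A^-)\le q\}\subset\Omega$ and $\{u: d(u,A^+)\le q\}\cap\overline\Omega=\emptyset$. Let $\mathcal A$ be the set of all $u\in W^{2,2}_{\rm loc}(\mathbb R;\mathbb R^m)$ for which there are numbers $x_u^-<x_u^+$ with $d(u(x),A^-)\le q$ for $x\le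 x_u^-$ and $d(u(x),A^+)\le q$ for $x\ge x_u^+$, and put $$J_{\mathbb R}(u)=\int_{\mathbb R}\Big(\tfrac12|u''|^2+W(u,u')\Big)\in[0,\infty].$$ Then there is $\bar u\in\mathcal A$ with $J_{\mathbb R}(\bar u)=\min_{u\in\mathcal A}J_{\mathbb R}(u)<+\infty$ such that moreover: 1. $\bar u\in C^4(\mathbb R;\mathbb R^m)$ and, on all of $\mathbb R$, $$\bar u''''+W_u(\bar u,\bar u')-W_{uv}(\bar u,\bar u')\,\bar u'-W_{vv}(\bar u,\bar u')\,\bar u''=0,$$ where $W_u,W_v\in\mathbb R^m$ are the partial gradients and $W_{uv}$, $W_{vv}$ are the derivatives of $W_v$ with respect to $u$ and $v$; 2. $\lim_{x\to-\infty}d(\bar u(x),A^-)=0$ and $\lim_{x\to+\infty}d(\bar u(x),A^+)=0$; 3. $\lim_{x\to\pm\infty}(\bar u'(x),\bar u''(x),\bar u'''(x))=(0,0,0)$; 4. $H:=\tfrac12|\bar u''|^2-W(\bar u,\bar u')+W_v(\bar u,\bar u')\cdot\bar u'-\bar u'''\cdot\bar u'=0$ for every $x\in\mathbb R$. -/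

import Mathlib

open Set Filter Topology MeasureTheory
open scoped ContDiff ENNReal

noncomputable section

namespace FourthOrder

/-- `ℝᵐ` with its Euclidean norm. -/
abbrev Vec (m : ℕ) : Type := EuclideanSpace ℝ (Fin m)

variable {m : ℕ}

/-! Sobolev class on the line, through weak derivatives. -/

/-- `v` is a weak (distributional) derivative of `u` on `ℝ`. -/
def HasWeakDeriv (u v : ℝ → Vec m) : Prop :=
  LocallyIntegrable u ∧ LocallyIntegrable v ∧
    ∀ φ : ℝ → ℝ, ContDiff ℝ ∞ φ → HasCompactSupport φ →
      ∫ x, deriv φ x • u x = -∫ x, φ x • v x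

/-- `u ∈ L²_loc(ℝ; ℝᵐ)`. -/
def MemL2loc (u : ℝ → Vec m) : Prop :=
  ∀ K : Set ℝ, IsCompact K → MemLp u 2 (volume.restrict K)

/-- `u ∈ W^{2,2}_loc(ℝ; ℝᵐ)`: `u` and its weak derivatives of orders one and two are in `L²_loc`. -/
def MemW22loc (u : ℝ → Vec m) : Prop :=
  MemL2loc u ∧ ∃ v w : ℝ → Vec m,
    HasWeakDeriv u v ∧ MemL2loc v ∧ HasWeakDeriv v w ∧ MemL2loc w

/-- Weak derivatives are unique almost everywhere. -/
theorem HasWeakDeriv.unique {u v w : ℝ → Vec m}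
    (hv : HasWeakDeriv u v) (hw : HasWeakDeriv u w) : v =ᵐ[volume] w := by
  refine ae_eq_of_integral_contDiff_smul_eq hv.2.1 hw.2.1 ?_
  intro φ hφ hc
  have h1 := hv.2.2 φ hφ hc
  have h2 := hw.2.2 φ hφ hc
  exact neg_injective (h1.symm.trans h2)

open Classical in
/-- A representative of the weak derivative of `u` (which is unique almost everywhere);
zero if `u` has no weak derivative. -/
def weakDeriv (u : ℝ → Vec m) : ℝ → Vec m :=
  if h : ∃ v, HasWeakDeriv u v then h.choose else 0

theorem HasWeakDeriv.weakDeriv_ae_eq {u v : ℝ → Vec m} (hv : HasWeakDeriv u v) :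
    weakDeriv u =ᵐ[volume] v := by
  have h : ∃ v, HasWeakDeriv u v := ⟨v, hv⟩
  have : weakDeriv u = h.choose := by simp [weakDeriv, h]
  rw [this]
  exact h.choose_spec.unique hv

/-- The energy `J(u) = ∫ (½ |u''|² + W(u, u'))`, with values in `[0, ∞]`
(derivatives in the weak sense; the integrand is nonnegative when `W ≥ 0`). -/
def energy (W : Vec m → Vec m → ℝ) (u : ℝ → Vec m) : ℝ≥0∞ :=
  ∫⁻ x, ENNReal.ofReal
    (1 / 2 * ‖weakDeriv (weakDeriv u) x‖ ^ 2 + W (u x) (weakDeriv u x))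

/-! Hypotheses on the potential. -/

/-- The zero set of `W(·, 0)` is partitioned into two nonempty disjoint compact sets. -/
structure HypH1 (W : Vec m → Vec m → ℝ) (Aminus Aplus : Set (Vec m)) : Prop where
  union_eq : Aminus ∪ Aplus = {u | W u 0 = 0}
  disjoint : Disjoint Aminus Aplus
  nonempty_minus : Aminus.Nonempty
  nonempty_plus : Aplus.Nonempty
  compact_minus : IsCompact Aminus
  compact_plus : IsCompact Aplus

/-- The open set `Ω` separates `A⁻` from `A⁺`, and `W(u, v) > 0` for `u ∈ ∂Ω` and every `v`. -/
structure HypH2 (W : Vec m → Vec m → ℝ) (Aminus Aplus Ω : Set (Vec m)) : Prop where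
  isOpen : IsOpen Ω
  subset : Aminus ⊆ Ω
  disjoint : Disjoint Aplus (closure Ω)
  pos : ∀ u ∈ frontier Ω, ∀ v, 0 < W u v

/-- `liminf_{|u| → ∞} W(u, v) > 0`, uniformly in `v`. -/
def HypH3 (W : Vec m → Vec m → ℝ) : Prop :=
  ∃ c : ℝ, 0 < c ∧ ∃ R : ℝ, ∀ u v : Vec m, R ≤ ‖u‖ → c ≤ W u v

/-- The Euclidean distance between two (nonempty) sets. -/
def setDist (S T : Set (Vec m)) : ℝ := sInf (image2 dist S T)

/-- The admissible radii `q`. -/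
structure AdmissibleRadius (Aminus Aplus Ω : Set (Vec m)) (q : ℝ) : Prop where
  pos : 0 < q
  lt : q < setDist Aminus Aplus / 2
  subset : {u | Metric.infDist u Aminus ≤ q} ⊆ Ω
  disjoint : Disjoint {u | Metric.infDist u Aplus ≤ q} (closure Ω)

/-- The class `𝒜` of connecting maps. As elements of `W^{2,2}_loc` are defined up to null sets,
the bounds are required almost everywhere; for the continuous representative this is the same as
requiring them at every point. -/
def connectingClass (Aminus Aplus : Set (Vec m)) (q : ℝ) : Set (ℝ → Vec m) :=
  {u | MemW22loc u ∧ ∃ a b : ℝ, a < b ∧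
    (∀ᵐ x : ℝ, x ≤ a → Metric.infDist (u x) Aminus ≤ q) ∧
    (∀ᵐ x : ℝ, b ≤ x → Metric.infDist (u x) Aplus ≤ q)}

/-! Partial derivatives of `W = W(u, v)`. -/

/-- `W_u(u, v) ∈ ℝᵐ`. -/
def gradU (W : Vec m → Vec m → ℝ) (u v : Vec m) : Vec m := gradient (fun u' => W u' v) u

/-- `W_v(u, v) ∈ ℝᵐ`. -/
def gradV (W : Vec m → Vec m → ℝ) (u v : Vec m) : Vec m := gradient (fun v' => W u v') v

/-- `W_{uv}(u, v)`, the derivative in `u` of `W_v`: `(W_{uv} ξ)_i = ∑_j ∂_{u_j} ∂_{v_i} W ξ_j`. -/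
def hessUV (W : Vec m → Vec m → ℝ) (u v : Vec m) : Vec m →L[ℝ] Vec m :=
  fderiv ℝ (fun u' => gradV W u' v) u

/-- `W_{vv}(u, v)`, the derivative in `v` of `W_v`. -/
def hessVV (W : Vec m → Vec m → ℝ) (u v : Vec m) : Vec m →L[ℝ] Vec m :=
  fderiv ℝ (fun v' => gradV W u v') v

/-- `u` satisfies `u'''' + W_u(u,u') - W_{uv}(u,u') u' - W_{vv}(u,u') u'' = 0` at every point
(meaningful for `u` of class `C⁴`). -/
def SolvesEulerLagrange (W : Vec m → Vec m → ℝ) (u : ℝ → Vec m) : Prop :=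
  ∀ x : ℝ, iteratedDeriv 4 u x + gradU W (u x) (deriv u x)
    - hessUV W (u x) (deriv u x) (deriv u x)
    - hessVV W (u x) (deriv u x) (iteratedDeriv 2 u x) = 0

/-- The Hamiltonian `H = ½ |u''|² - W(u,u') + W_v(u,u') · u' - u''' · u'`. -/
def hamiltonian (W : Vec m → Vec m → ℝ) (u : ℝ → Vec m) (x : ℝ) : ℝ :=
  1 / 2 * ‖iteratedDeriv 2 u x‖ ^ 2 - W (u x) (deriv u x)
    + inner ℝ (gradV W (u x) (deriv u x)) (deriv u x)
    - inner ℝ (iteratedDeriv 3 u x) (deriv u x)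

end FourthOrder

end

open FourthOrder

/-! The direct method applies, with two difficulties: the potential gives no control of large
velocities, and translations destroy compactness.

Bounds. Energy controls the oscillation of the velocity on bounded windows
(`IsPath.norm_velocity_sub_le`). A very large velocity would therefore carry the path into `R ≤
‖u‖`, where `W ≥ c`, and keep it there longer than the energy allows (`exists_velocity_bound`). A
position bound follows in the same way, so paths of bounded energy move in a fixed compact set of
pairs (position, velocity).

Locating the transition. Cutting and pasting paths would require matching velocities as well as
positions, so the minimizing sequence is not modified. By compactness each visit to `∂Ω` costs a
fixed amount of energy, hence the number of well separated visits is bounded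
(`exists_card_crossing_le`). Along a subsequence the visits lie within a fixed distance `L` of
finitely many centres whose mutual distances tend to infinity (`exists_cluster_centres`). Near one
centre the path passes from a long stay inside `Ω` to a long stay outside (`exists_transition`), and
the path is translated to put that centre at the origin. Weak compactness of the accelerations and
Fatou's lemma give a limit whose energy is at most the infimum (`exists_limit_path`). The limit lies
in `closure Ω` to the left of `-L` and outside `Ω` to the right of `L`. Finite energy forces it
towards `A⁻ ∪ A⁺` at both ends, and the side of `Ω` decides which part, so the limit belongs to the
class.

Equation and asymptotics. Membership in the class constrains a path only near infinity, so
perturbation by test functions is admissible and gives the weak Euler–Lagrange equation. The lemma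
of du Bois-Reymond, used twice, turns it into an integrated equation for the third derivative and
yields regularity. Boundedness of `u` and vanishing of the energy on distant windows give `u' → 0`;
the gradients of `W` vanish at its zeros, so `u'''` oscillates little far out, and finite
differences of `u'` give the decay of `u''` and `u'''`. Finally the Hamiltonian is constant and
tends to zero. -/

noncomputable section

namespace FourthOrder

variable {m : ℕ}

/-! ### Test functions and the lemma of du Bois-Reymond -/

/-- A smooth compactly supported function on the line. -/
structure IsTest (φ : ℝ → ℝ) : Prop where
  smooth : ContDiff ℝ ∞ φ
  compact : HasCompactSupport φ

namespace IsTest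

variable {φ ψ : ℝ → ℝ}

theorem continuous (h : IsTest φ) : Continuous φ := h.smooth.continuous

theorem hasDerivAt (h : IsTest φ) (x : ℝ) : HasDerivAt φ (deriv φ x) x :=
  (h.smooth.differentiable (by simp)).differentiableAt.hasDerivAt

theorem deriv (h : IsTest φ) : IsTest (deriv φ) :=
  ⟨((contDiff_infty_iff_deriv (𝕜 := ℝ)).1 h.smooth).2, h.compact.deriv⟩

theorem const_mul (h : IsTest φ) (c : ℝ) : IsTest (fun x => c * φ x) :=
  ⟨contDiff_const.mul h.smooth, h.compact.mul_left⟩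

theorem sub (h : IsTest φ) (h' : IsTest ψ) : IsTest (fun x => φ x - ψ x) :=
  ⟨h.smooth.sub h'.smooth, h.compact.sub h'.compact⟩

theorem exists_tsupport_subset (h : IsTest φ) : ∃ r : ℝ, 0 < r ∧ tsupport φ ⊆ Ioo (-r) r := by
  obtain ⟨r, hr⟩ := h.compact.isCompact.isBounded.subset_ball 0
  refine ⟨max r 1, by positivity, hr.trans ?_⟩
  rw [Real.ball_eq_Ioo]
  exact Ioo_subset_Ioo (by simp) (by simp)

theorem integrable (h : IsTest φ) : Integrable φ :=
  h.continuous.integrable_of_hasCompactSupport h.compact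

theorem integrable_smul {E : Type*} [NormedAddCommGroup E] [NormedSpace ℝ E] (h : IsTest φ)
    {f : ℝ → E} (hf : LocallyIntegrable f) : Integrable fun x => φ x • f x :=
  hf.integrable_smul_left_of_hasCompactSupport h.continuous h.compact

end IsTest

theorem eq_zero_of_tsupport_subset {φ : ℝ → ℝ} {a b x : ℝ} (h : tsupport φ ⊆ Ioo a b)
    (hx : x ∉ Ioo a b) : φ x = 0 :=
  image_eq_zero_of_notMem_tsupport fun h' => hx (h h')

/-- Integration by parts of a test function against the primitive of a locally integrable
function. -/
theorem integral_deriv_mul_primitive {g : ℝ → ℝ} (hg : LocallyIntegrable g) {φ : ℝ → ℝ}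
    (hφ : IsTest φ) :
    ∫ x, deriv φ x * (∫ t in (0 : ℝ)..x, g t) = -∫ x, φ x * g x := by
  obtain ⟨r, hr, hs⟩ := hφ.exists_tsupport_subset
  have hI : IntervalIntegrable g volume (-r) r :=
    (hg.integrableOn_isCompact isCompact_uIcc).intervalIntegrable
  have hF : AbsolutelyContinuousOnInterval (fun x => ∫ t in (0 : ℝ)..x, g t) (-r) r :=
    hI.absolutelyContinuousOnInterval_intervalIntegral
      (by rw [mem_uIcc]; left; constructor <;> linarith)
  have hφa : AbsolutelyContinuousOnInterval φ (-r) r :=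
    (hφ.smooth.of_le (by simp)).contDiffOn.absolutelyContinuousOnInterval
  -- The primitive is only absolutely continuous, so integration by parts is used in that class; the
  -- boundary terms vanish because the support of `φ` lies inside the interval.
  have key := hφa.integral_mul_deriv_eq_deriv_mul hF
  rw [eq_zero_of_tsupport_subset hs (x := r) (by simp),
    eq_zero_of_tsupport_subset hs (x := -r) (by simp)] at key
  have e1 : ∫ x, deriv φ x * (∫ t in (0 : ℝ)..x, g t)
      = ∫ x in (-r)..r, deriv φ x * (∫ t in (0 : ℝ)..x, g t) := by
    refine (intervalIntegral.integral_eq_integral_of_support_subset fun x hx => ?_).symm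
    refine Ioo_subset_Ioc_self (hs ?_)
    exact support_deriv_subset (left_ne_zero_of_mul hx)
  have e2 : ∫ x, φ x * g x = ∫ x in (-r)..r, φ x * g x := by
    refine (intervalIntegral.integral_eq_integral_of_support_subset fun x hx => ?_).symm
    refine Ioo_subset_Ioc_self (hs ?_)
    exact subset_tsupport _ (left_ne_zero_of_mul hx)
  have e3 : ∫ x in (-r)..r, φ x * deriv (fun x => ∫ t in (0 : ℝ)..x, g t) x
      = ∫ x in (-r)..r, φ x * g x := by
    refine intervalIntegral.integral_congr_ae ?_
    filter_upwards [_root_.LocallyIntegrable.ae_hasDerivAt_integral hg] with x hx _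
    rw [(hx 0).deriv]
  rw [e1, e2, ← e3, key]
  ring

theorem inner_intervalIntegral {g : ℝ → Vec m} (hg : LocallyIntegrable g) (e : Vec m) (a b : ℝ) :
    inner ℝ e (∫ t in a..b, g t) = ∫ t in a..b, inner ℝ e (g t) :=
  ((innerSL ℝ e).intervalIntegral_comp_comm
    (hg.integrableOn_isCompact isCompact_uIcc).intervalIntegrable).symm

theorem locallyIntegrable_inner {g : ℝ → Vec m} (hg : LocallyIntegrable g) (e : Vec m) :
    LocallyIntegrable fun t => inner ℝ e (g t) := by
  intro x
  obtain ⟨s, hs, hi⟩ := hg x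
  exact ⟨s, hs, (innerSL ℝ e).integrable_comp hi⟩

theorem continuous_primitive {g : ℝ → Vec m} (hg : LocallyIntegrable g) :
    Continuous fun x => ∫ t in (0 : ℝ)..x, g t :=
  intervalIntegral.continuous_primitive
    (fun _ _ => (hg.integrableOn_isCompact isCompact_uIcc).intervalIntegrable) 0

theorem integral_deriv_smul_primitive {g : ℝ → Vec m} (hg : LocallyIntegrable g) {φ : ℝ → ℝ}
    (hφ : IsTest φ) :
    ∫ x, deriv φ x • (∫ t in (0 : ℝ)..x, g t) = -∫ x, φ x • g x := by
  refine ext_inner_left ℝ fun e => ?_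
  rw [inner_neg_right, ← integral_inner (hφ.integrable_smul hg),
    ← integral_inner (hφ.deriv.integrable_smul (continuous_primitive hg).locallyIntegrable)]
  simp only [inner_smul_right, inner_intervalIntegral hg]
  exact integral_deriv_mul_primitive (locallyIntegrable_inner hg e) hφ

theorem HasWeakDeriv.primitive {g : ℝ → Vec m} (hg : LocallyIntegrable g) (c : Vec m) :
    HasWeakDeriv (fun x => c + ∫ t in (0 : ℝ)..x, g t) g := by
  refine ⟨((continuous_const).add (continuous_primitive hg)).locallyIntegrable, hg,
    fun φ h1 h2 => ?_⟩
  have hφ : IsTest φ := ⟨h1, h2⟩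
  have h0 : ∫ x, deriv φ x = 0 :=
    integral_eq_zero_of_hasDerivAt_of_integrable hφ.hasDerivAt hφ.deriv.integrable hφ.integrable
  simp only [smul_add]
  rw [integral_add (hφ.deriv.integrable.smul_const c)
    (hφ.deriv.integrable_smul (continuous_primitive hg).locallyIntegrable),
    integral_deriv_smul_primitive hg hφ, integral_smul_const, h0]
  simp

theorem exists_test_integral_eq_one : ∃ ρ : ℝ → ℝ, IsTest ρ ∧ ∫ x, ρ x = 1 := by
  let b : ContDiffBump (0 : ℝ) := default
  exact ⟨b.normed volume, ⟨b.contDiff_normed, b.hasCompactSupport_normed⟩, b.integral_normed⟩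

/-- A test function of zero mean is the derivative of a test function. -/
theorem IsTest.exists_deriv_eq {ψ : ℝ → ℝ} (hψ : IsTest ψ) (h0 : ∫ x, ψ x = 0) :
    ∃ φ, IsTest φ ∧ _root_.deriv φ = ψ := by
  obtain ⟨r, hr, hs⟩ := hψ.exists_tsupport_subset
  have hd : ∀ x, HasDerivAt (fun x => ∫ t in (-r)..x, ψ t) (ψ x) x := fun x =>
    intervalIntegral.integral_hasDerivAt_right (hψ.continuous.intervalIntegrable _ _)
      (hψ.continuous.stronglyMeasurableAtFilter _ _) hψ.continuous.continuousAt
  have hde : _root_.deriv (fun x => ∫ t in (-r)..x, ψ t) = ψ := funext fun x => (hd x).deriv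
  refine ⟨fun x => ∫ t in (-r)..x, ψ t, ⟨?_, ?_⟩, hde⟩
  · rw [contDiff_infty_iff_deriv, hde]
    exact ⟨fun x => (hd x).differentiableAt, hψ.smooth⟩
  · refine HasCompactSupport.intro (isCompact_Icc (a := -r) (b := r)) fun x hx => ?_
    rcases lt_or_ge x (-r) with h | h
    · have : ∀ t ∈ uIcc (-r) x, ψ t = 0 := fun t ht => by
        rw [uIcc_of_ge h.le] at ht
        exact eq_zero_of_tsupport_subset hs fun h' => by linarith [ht.2, h'.1]
      exact (intervalIntegral.integral_congr this).trans (by simp)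
    · have hrx : r < x := by
        by_contra h'
        exact hx ⟨h, not_lt.1 h'⟩
      rw [intervalIntegral.integral_eq_integral_of_support_subset, h0]
      exact fun t ht => ⟨(hs (subset_tsupport _ ht)).1, ((hs (subset_tsupport _ ht)).2.trans hrx).le⟩

/-- The lemma of du Bois-Reymond: a function with zero weak derivative is constant. -/
theorem ae_eq_const_of_integral_deriv_smul_eq_zero {f : ℝ → Vec m} (hf : LocallyIntegrable f)
    (h : ∀ φ, IsTest φ → ∫ x, deriv φ x • f x = 0) : ∃ c, f =ᵐ[volume] fun _ => c := by
  obtain ⟨ρ, hρ, hρ1⟩ := exists_test_integral_eq_one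
  refine ⟨∫ x, ρ x • f x, ?_⟩
  refine ae_eq_of_integral_contDiff_smul_eq hf continuous_const.locallyIntegrable
    fun ψ h1 h2 => ?_
  have hψ : IsTest ψ := ⟨h1, h2⟩
  -- Subtracting the multiple of `ρ` with the same mean leaves a test function of zero mean, hence
  -- the derivative of a test function.
  obtain ⟨φ, hφ, hd⟩ := (hψ.sub (hρ.const_mul (∫ x, ψ x))).exists_deriv_eq (by
    rw [integral_sub hψ.integrable (hρ.const_mul _).integrable, integral_const_mul, hρ1]; simp)
  have := h φ hφ
  simp only [hd, sub_smul, mul_smul] at this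
  rw [integral_sub (hψ.integrable_smul hf) ((hρ.integrable_smul hf).fun_smul _), integral_smul,
    sub_eq_zero] at this
  rw [this, integral_smul_const]

theorem HasWeakDeriv.exists_ae_eq_primitive {u v : ℝ → Vec m} (h : HasWeakDeriv u v) :
    ∃ c, u =ᵐ[volume] fun x => c + ∫ t in (0 : ℝ)..x, v t := by
  have hp := continuous_primitive h.2.1
  obtain ⟨c, hc⟩ := ae_eq_const_of_integral_deriv_smul_eq_zero
    (f := fun x => u x - ∫ t in (0 : ℝ)..x, v t) (h.1.sub hp.locallyIntegrable) fun φ hφ => by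
      simp only [smul_sub]
      rw [integral_sub (hφ.deriv.integrable_smul h.1) (hφ.deriv.integrable_smul hp.locallyIntegrable),
        h.2.2 φ hφ.smooth hφ.compact, integral_deriv_smul_primitive h.2.1 hφ, sub_self]
  refine ⟨c, ?_⟩
  filter_upwards [hc] with x hx
  rw [← hx]; simp

/-- A function with zero second weak derivative is affine. -/
theorem ae_eq_affine_of_integral_deriv_deriv_smul_eq_zero {f : ℝ → Vec m}
    (hf : LocallyIntegrable f) (h : ∀ φ, IsTest φ → ∫ x, deriv (deriv φ) x • f x = 0) :
    ∃ a b, f =ᵐ[volume] fun x => a + x • b := by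
  obtain ⟨ρ, hρ, hρ1⟩ := exists_test_integral_eq_one
  -- The same splitting, differentiated once, shows that the weak derivative of `f` is a constant
  -- vector, identified by testing against `ρ`.
  have hw : HasWeakDeriv f fun _ => -∫ x, deriv ρ x • f x := by
    refine ⟨hf, continuous_const.locallyIntegrable, fun ψ h1 h2 => ?_⟩
    have hψ : IsTest ψ := ⟨h1, h2⟩
    obtain ⟨φ, hφ, hd⟩ := (hψ.sub (hρ.const_mul (∫ x, ψ x))).exists_deriv_eq (by
      rw [integral_sub hψ.integrable (hρ.const_mul _).integrable, integral_const_mul, hρ1]; simp)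
    have hdd : deriv (fun x => ψ x - (∫ x, ψ x) * ρ x)
        = fun x => deriv ψ x - (∫ x, ψ x) * deriv ρ x := funext fun x =>
      ((hψ.hasDerivAt x).sub ((hρ.hasDerivAt x).const_mul _)).deriv
    have := h φ hφ
    simp only [hd, hdd, sub_smul, mul_smul] at this
    rw [integral_sub (hψ.deriv.integrable_smul hf) ((hρ.deriv.integrable_smul hf).fun_smul _),
      integral_smul, sub_eq_zero] at this
    rw [this, integral_smul_const]
    simp
  obtain ⟨c, hc⟩ := hw.exists_ae_eq_primitive
  refine ⟨c, -∫ x, deriv ρ x • f x, hc.trans (Eventually.of_forall fun x => ?_)⟩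
  simp

/-! ### Paths with square integrable acceleration -/

theorem HasWeakDeriv.congr_left {u u' v : ℝ → Vec m} (h : HasWeakDeriv u v)
    (hu : u' =ᵐ[volume] u) : HasWeakDeriv u' v := by
  refine ⟨(locallyIntegrable_congr hu).2 h.1, h.2.1, fun φ h1 h2 => ?_⟩
  rw [← h.2.2 φ h1 h2]
  refine integral_congr_ae ?_
  filter_upwards [hu] with x hx
  rw [hx]

theorem MemL2loc.locallyIntegrable {u : ℝ → Vec m} (h : MemL2loc u) : LocallyIntegrable u := by
  rw [locallyIntegrable_iff]
  intro K hK
  have : IsFiniteMeasure (volume.restrict K) := ⟨by simpa using hK.measure_lt_top⟩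
  exact (h K hK).integrable (by norm_num)

theorem memL2loc_of_continuous {u : ℝ → Vec m} (h : Continuous u) : MemL2loc u := fun K hK => by
  have : IsFiniteMeasure (volume.restrict K) := ⟨by simpa using hK.measure_lt_top⟩
  obtain ⟨C, hC⟩ := hK.exists_bound_of_continuousOn h.continuousOn
  exact MemLp.of_bound h.aestronglyMeasurable C
    ((ae_restrict_iff' hK.measurableSet).2 (Eventually.of_forall hC))

/-- `u` is a path with velocity `v` and square integrable acceleration `w`. -/
structure IsPath (u v w : ℝ → Vec m) : Prop where
  hasDerivAt : ∀ x, HasDerivAt u (v x) x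
  velocity_eq : ∀ x, v x = v 0 + ∫ t in (0 : ℝ)..x, w t
  memLp : MemLp w 2 volume

/-- The integrand of the energy along a path. -/
def density (W : Vec m → Vec m → ℝ) (u v w : ℝ → Vec m) (x : ℝ) : ℝ :=
  1 / 2 * ‖w x‖ ^ 2 + W (u x) (v x)

/-- The energy of a path. -/
def action (W : Vec m → Vec m → ℝ) (u v w : ℝ → Vec m) : ℝ≥0∞ :=
  ∫⁻ x, ENNReal.ofReal (density W u v w x)

theorem hasDerivAt_add_primitive {v : ℝ → Vec m} (hv : Continuous v) (c : Vec m) (x : ℝ) :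
    HasDerivAt (fun x => c + ∫ t in (0 : ℝ)..x, v t) (v x) x :=
  (intervalIntegral.integral_hasDerivAt_right (hv.intervalIntegrable _ _)
    (hv.stronglyMeasurableAtFilter _ _) hv.continuousAt).const_add c

namespace IsPath

variable {u v w : ℝ → Vec m} {W : Vec m → Vec m → ℝ}

theorem memL2loc (h : IsPath u v w) : MemL2loc w := fun _ _ => h.memLp.restrict _

theorem locallyIntegrable (h : IsPath u v w) : LocallyIntegrable w :=
  h.memL2loc.locallyIntegrable

theorem intervalIntegrable (h : IsPath u v w) (a b : ℝ) : IntervalIntegrable w volume a b :=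
  (h.locallyIntegrable.integrableOn_isCompact isCompact_uIcc).intervalIntegrable

theorem continuous_velocity (h : IsPath u v w) : Continuous v := by
  rw [funext h.velocity_eq]
  exact continuous_const.add (continuous_primitive h.locallyIntegrable)

theorem continuous (h : IsPath u v w) : Continuous u :=
  continuous_iff_continuousAt.2 fun x => (h.hasDerivAt x).continuousAt

theorem eq_add_integral (h : IsPath u v w) (x : ℝ) : u x = u 0 + ∫ t in (0 : ℝ)..x, v t := by
  rw [intervalIntegral.integral_eq_sub_of_hasDerivAt (fun t _ => h.hasDerivAt t)
    (h.continuous_velocity.intervalIntegrable _ _)]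
  simp

theorem velocity_sub (h : IsPath u v w) (x y : ℝ) : v y - v x = ∫ t in x..y, w t := by
  rw [h.velocity_eq x, h.velocity_eq y, ← intervalIntegral.integral_add_adjacent_intervals
    (h.intervalIntegrable 0 x) (h.intervalIntegrable x y)]
  abel

theorem hasWeakDeriv (h : IsPath u v w) : HasWeakDeriv u v := by
  rw [funext h.eq_add_integral]
  exact HasWeakDeriv.primitive h.continuous_velocity.locallyIntegrable _

theorem hasWeakDeriv_velocity (h : IsPath u v w) : HasWeakDeriv v w := by
  rw [funext h.velocity_eq]
  exact HasWeakDeriv.primitive h.locallyIntegrable _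

theorem memW22loc (h : IsPath u v w) : MemW22loc u :=
  ⟨memL2loc_of_continuous h.continuous, v, w, h.hasWeakDeriv, memL2loc_of_continuous h.continuous_velocity,
    h.hasWeakDeriv_velocity, h.memL2loc⟩

end IsPath

/-- Weak derivatives are unique up to null sets, so the energy may be computed from any
representatives, in particular from the continuous ones. -/
theorem energy_eq_lintegral {W : Vec m → Vec m → ℝ} {u p v w : ℝ → Vec m}
    (hu : u =ᵐ[volume] p) (hv : HasWeakDeriv u v) (hw : HasWeakDeriv v w) :
    energy W u = ∫⁻ x, ENNReal.ofReal (1 / 2 * ‖w x‖ ^ 2 + W (p x) (v x)) := by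
  refine lintegral_congr_ae ?_
  filter_upwards [hu, hv.weakDeriv_ae_eq, (hw.congr_left hv.weakDeriv_ae_eq).weakDeriv_ae_eq]
    with x h1 h2 h3
  rw [h1, h2, h3]

theorem IsPath.energy_eq {u v w : ℝ → Vec m} (h : IsPath u v w) (W : Vec m → Vec m → ℝ) :
    energy W u = action W u v w :=
  energy_eq_lintegral EventuallyEq.rfl h.hasWeakDeriv h.hasWeakDeriv_velocity

/-- The continuous representative of a Sobolev map of finite energy. -/
theorem exists_isPath_of_energy_lt_top {W : Vec m → Vec m → ℝ} (hW0 : ∀ u v, 0 ≤ W u v)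
    {u : ℝ → Vec m} (hu : MemW22loc u) (hE : energy W u < ⊤) :
    ∃ p v w, IsPath p v w ∧ u =ᵐ[volume] p ∧ energy W u = action W p v w := by
  obtain ⟨-, v, w, hv, -, hw, hw2⟩ := hu
  obtain ⟨c, hc⟩ := hw.exists_ae_eq_primitive
  set v' : ℝ → Vec m := fun x => c + ∫ t in (0 : ℝ)..x, w t with hv'
  have hv'c : Continuous v' := continuous_const.add (continuous_primitive hw.2.1)
  obtain ⟨d, hd⟩ := hv.exists_ae_eq_primitive
  set p : ℝ → Vec m := fun x => d + ∫ t in (0 : ℝ)..x, v' t with hp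
  have hup : u =ᵐ[volume] p := by
    refine hd.trans (Eventually.of_forall fun x => ?_)
    simp only [hp]
    congr 1
    exact intervalIntegral.integral_congr_ae (hc.mono fun t ht _ => ht)
  have hvv : HasWeakDeriv u v' := by
    have : HasWeakDeriv p v' := HasWeakDeriv.primitive hv'c.locallyIntegrable d
    exact this.congr_left hup
  have hww : HasWeakDeriv v' w := hw.congr_left hc.symm
  have hEe := energy_eq_lintegral (W := W) hup hvv hww
  have hwm : AEStronglyMeasurable w volume := hw.2.1.aestronglyMeasurable
  refine ⟨p, v', w, ⟨fun x => hasDerivAt_add_primitive hv'c d x, fun x => by simp [hv'], ?_⟩,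
    hup, hEe⟩
  rw [memLp_two_iff_integrable_sq_norm hwm]
  have hi : Integrable (fun x => 1 / 2 * ‖w x‖ ^ 2) := by
    refine ⟨(hwm.norm.pow 2).const_mul _, ?_⟩
    rw [hasFiniteIntegral_iff_ofReal (Eventually.of_forall fun x => by positivity)]
    refine lt_of_le_of_lt (lintegral_mono fun x => ENNReal.ofReal_le_ofReal ?_) (hEe ▸ hE)
    linarith [hW0 (p x) (v' x)]
  refine (hi.const_mul 2).congr (Eventually.of_forall fun x => ?_)
  simp only
  ring

namespace IsPath

variable {u v w : ℝ → Vec m} {W : Vec m → Vec m → ℝ}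

theorem continuous_potential (h : IsPath u v w)
    (hW : Continuous fun p : Vec m × Vec m => W p.1 p.2) : Continuous fun x => W (u x) (v x) :=
  hW.comp (h.continuous.prodMk h.continuous_velocity)

theorem integrable_sq (h : IsPath u v w) : Integrable fun x => 1 / 2 * ‖w x‖ ^ 2 :=
  ((memLp_two_iff_integrable_sq_norm h.memLp.1).1 h.memLp).const_mul _

theorem aestronglyMeasurable_density (h : IsPath u v w)
    (hW : Continuous fun p : Vec m × Vec m => W p.1 p.2) :
    AEStronglyMeasurable (density W u v w) volume :=
  h.integrable_sq.1.add (h.continuous_potential hW).aestronglyMeasurable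

theorem density_nonneg (hW0 : ∀ u v, 0 ≤ W u v) (x : ℝ) : 0 ≤ density W u v w x :=
  add_nonneg (by positivity) (hW0 _ _)

theorem integrable_density (h : IsPath u v w)
    (hW : Continuous fun p : Vec m × Vec m => W p.1 p.2) (hW0 : ∀ u v, 0 ≤ W u v)
    (hA : action W u v w < ⊤) : Integrable (density W u v w) :=
  ⟨h.aestronglyMeasurable_density hW, by
    rwa [hasFiniteIntegral_iff_ofReal (Eventually.of_forall fun x => density_nonneg hW0 x)]⟩

theorem integral_density_le (h : IsPath u v w)
    (hW : Continuous fun p : Vec m × Vec m => W p.1 p.2) (hW0 : ∀ u v, 0 ≤ W u v) {C : ℝ}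
    (hC : 0 ≤ C) (hA : action W u v w ≤ ENNReal.ofReal C) :
    ∫ x, density W u v w x ≤ C := by
  rw [integral_eq_lintegral_of_nonneg_ae (Eventually.of_forall fun x => density_nonneg hW0 x)
    (h.aestronglyMeasurable_density hW)]
  exact ENNReal.toReal_le_of_le_ofReal hC hA

theorem setIntegral_density_le (hW0 : ∀ u v, 0 ≤ W u v)
    (hi : Integrable (density W u v w)) (S : Set ℝ) :
    ∫ x in S, density W u v w x ≤ ∫ x, density W u v w x :=
  setIntegral_le_integral hi (Eventually.of_forall fun x => density_nonneg hW0 x)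

/-- Lower bound of the energy on an interval where the potential is at least `c`. -/
theorem mul_le_integral_density (hi : Integrable (density W u v w)) {a b c : ℝ} (hab : a ≤ b)
    (hc : ∀ x ∈ Icc a b, c ≤ W (u x) (v x)) :
    c * (b - a) ≤ ∫ x in Icc a b, density W u v w x := by
  have h1 : ∫ _ in Icc a b, c = c * (b - a) := by
    simp [hab, mul_comm]
  rw [← h1]
  refine setIntegral_mono_on (integrableOn_const (by simp)) hi.integrableOn
    measurableSet_Icc fun x hx => (hc x hx).trans ?_
  simp only [density]
  have : 0 ≤ 1 / 2 * ‖w x‖ ^ 2 := by positivity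
  linarith

/-- The oscillation of the velocity is controlled by the energy. -/
theorem norm_velocity_sub_le (h : IsPath u v w) (hW0 : ∀ u v, 0 ≤ W u v)
    (hi : Integrable (density W u v w)) {x y k : ℝ} (hxy : x ≤ y) (hk : 0 < k) :
    ‖v y - v x‖ ≤ k * (y - x) / 2 + (∫ t in Icc x y, density W u v w t) / k := by
  rw [h.velocity_sub x y, intervalIntegral.integral_of_le hxy, ← integral_Icc_eq_integral_Ioc]
  have h1 : ∫ _ in Icc x y, k / 2 = k * (y - x) / 2 := by
    simp [hxy]; ring
  have h0 : IntegrableOn (fun _ => k / 2) (Icc x y) := integrableOn_const (by simp)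
  rw [← h1, ← integral_div, ← integral_add h0 (hi.integrableOn.div_const k)]
  refine norm_integral_le_of_norm_le (h0.add (hi.integrableOn.div_const k))
    (Eventually.of_forall fun t => ?_)
  have h2 : 1 / 2 * ‖w t‖ ^ 2 ≤ density W u v w t := by
    simp only [density]; linarith [hW0 (u t) (v t)]
  rw [← sub_nonneg]
  -- Young's inequality with a free weight `k`: a small `k` suits long windows of small energy, a
  -- large `k` suits short windows.
  have h3 : k / 2 + 1 / 2 * ‖w t‖ ^ 2 / k - ‖w t‖ = (‖w t‖ - k) ^ 2 / (2 * k) := by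
    field_simp; ring
  have h4 : 0 ≤ (‖w t‖ - k) ^ 2 / (2 * k) := by positivity
  have h5 : 1 / 2 * ‖w t‖ ^ 2 / k ≤ density W u v w t / k := by gcongr
  linarith

/-- Translation of a path. -/
theorem comp_add (h : IsPath u v w) (y : ℝ) :
    IsPath (fun x => u (x + y)) (fun x => v (x + y)) (fun x => w (x + y)) where
  hasDerivAt x := (h.hasDerivAt (x + y)).comp_add_const x y
  velocity_eq x := by
    have := h.velocity_sub y (x + y)
    rw [intervalIntegral.integral_comp_add_right, zero_add, ← this]
    abel
  memLp := h.memLp.comp_measurePreserving (measurePreserving_add_right volume y)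

end IsPath

/-! ### Uniform bounds for paths of bounded energy -/

/-- The mean value inequality for `u t - t • a`. It is used with `a = 0` as a Lipschitz bound and
with `a` the initial velocity as a first-order Taylor estimate. -/
theorem norm_sub_sub_smul_le {E : Type*} [NormedAddCommGroup E] [NormedSpace ℝ E] {u v : ℝ → E}
    {x y D : ℝ} {a : E} (h : ∀ t, HasDerivAt u (v t) t)
    (hb : ∀ t ∈ uIcc x y, ‖v t - a‖ ≤ D) : ‖u y - u x - (y - x) • a‖ ≤ D * |y - x| := by
  have := (convex_uIcc x y).norm_image_sub_le_of_norm_hasDerivWithin_le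
    (f := fun t => u t - t • a) (f' := fun t => v t - a) (C := D) (x := x) (y := y)
    (fun t _ => by simpa using! ((h t).sub ((hasDerivAt_id t).smul_const a)).hasDerivWithinAt)
    hb left_mem_uIcc right_mem_uIcc
  rw [Real.norm_eq_abs] at this
  convert this using 2
  rw [sub_smul]; abel

section

variable {u v w : ℝ → Vec m} {W : Vec m → Vec m → ℝ} {C : ℝ}

/-- A velocity much larger than its own possible oscillation makes the motion nearly straight, so at
least one of the two time directions leads away from the origin and stays in `R ≤ ‖u‖` for a time
`l`, which costs more than `C`. -/
theorem exists_velocity_bound (hW0 : ∀ u v, 0 ≤ W u v) (h3 : HypH3 W) (C : ℝ) :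
    ∃ M : ℝ, 0 < M ∧ ∀ u v w : ℝ → Vec m, IsPath u v w → Integrable (density W u v w) →
      ∫ x, density W u v w x ≤ C → ∀ x, ‖v x‖ ≤ M := by
  obtain ⟨c, hc, R, hR⟩ := h3
  -- A time long enough that `W ≥ c` throughout it costs more than `C`.
  set l : ℝ := |C| / c + 1 with hl
  have hl0 : 0 < l := by positivity
  have hcl : C < c * l := by
    have : c * l = |C| + c := by rw [hl]; field_simp
    linarith [le_abs_self C]
  -- The oscillation bound with weight `k = 1` on windows of length at most `l + 1`.
  set D : ℝ := (l + 1) / 2 + |C| with hD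
  have hD0 : 0 < D := by positivity
  refine ⟨2 * D + 2 * |R|, by positivity, fun u v w h hi hC x => ?_⟩
  by_contra! hM
  have hM0 : 0 < ‖v x‖ := by linarith [abs_nonneg R]
  have hosc1 : ∀ s t, s ≤ t → t - s ≤ l + 1 → ‖v t - v s‖ ≤ D := fun s t hst hle => by
    have h1 := h.norm_velocity_sub_le hW0 hi hst one_pos
    have h2 := (IsPath.setIntegral_density_le hW0 hi (Icc s t)).trans hC
    rw [hD]
    linarith [le_abs_self C]
  have hosc : ∀ t, |t - x| ≤ l + 1 → ‖v t - v x‖ ≤ D := fun t ht => by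
    rw [abs_le] at ht
    rcases le_total x t with h' | h'
    · exact hosc1 x t h' (by linarith)
    · rw [norm_sub_rev]
      exact hosc1 t x h' (by linarith)
  -- Project `u y` on `v x`. The sign condition prevents cancellation between the initial position
  -- and the displacement, and a time lapse of at least `1` gives `‖u y‖ ≥ ‖v x‖ - D`.
  have hfar : ∀ y, |y - x| ≤ l + 1 → 1 ≤ |y - x| →
      0 ≤ (y - x) * inner ℝ (u x) (v x) → R ≤ ‖u y‖ := fun y hy hy1 hs => by
    have hE := norm_sub_sub_smul_le (x := x) (y := y) (a := v x) (D := D) h.hasDerivAt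
      fun t ht => hosc t ((abs_sub_left_of_mem_uIcc ht).trans hy)
    set E := u y - u x - (y - x) • v x with hEd
    have huy : u y = u x + (y - x) • v x + E := by rw [hEd]; abel
    have h1 : inner ℝ (u y) (v x)
        = inner ℝ (u x) (v x) + (y - x) * ‖v x‖ ^ 2 + inner ℝ E (v x) := by
      rw [huy, inner_add_left, inner_add_left, real_inner_smul_left, real_inner_self_eq_norm_sq]
    have h2 : |inner ℝ E (v x)| ≤ D * |y - x| * ‖v x‖ :=
      (abs_real_inner_le_norm _ _).trans (by gcongr)
    have h3 : |inner ℝ (u y) (v x)| ≤ ‖u y‖ * ‖v x‖ := abs_real_inner_le_norm _ _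
    have h4 : |y - x| * ‖v x‖ ^ 2 - D * |y - x| * ‖v x‖ ≤ |inner ℝ (u y) (v x)| := by
      rw [h1]
      rcases le_or_gt 0 (y - x) with hp | hn
      · rw [abs_of_nonneg hp] at h2 hy1 ⊢
        have : 0 ≤ inner ℝ (u x) (v x) := by
          by_contra! hneg
          nlinarith
        refine le_trans ?_ (le_abs_self _)
        linarith [(abs_le.1 h2).1]
      · rw [abs_of_neg hn] at h2 hy1 ⊢
        have : inner ℝ (u x) (v x) ≤ 0 := by
          by_contra! hneg
          nlinarith
        refine le_trans ?_ (neg_le_abs _)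
        linarith [(abs_le.1 h2).2]
    have h5 : (‖v x‖ - D) * ‖v x‖ ≤ ‖u y‖ * ‖v x‖ := by
      have : 0 ≤ (|y - x| - 1) * ((‖v x‖ - D) * ‖v x‖) := by
        have : 0 ≤ ‖v x‖ - D := by linarith [abs_nonneg R]
        have : 0 ≤ |y - x| - 1 := by linarith
        positivity
      nlinarith
    have h6 := le_of_mul_le_mul_right h5 hM0
    linarith [le_abs_self R, abs_nonneg R]
  rcases le_total 0 (inner ℝ (u x) (v x)) with hs | hs
  · have := IsPath.mul_le_integral_density hi (a := x + 1) (b := x + 1 + l) (c := c) (by linarith)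
      fun y hy => hR _ _ (hfar y (by rw [abs_of_nonneg] <;> linarith [hy.1, hy.2])
        (by rw [abs_of_nonneg] <;> linarith [hy.1])
        (mul_nonneg (by linarith [hy.1]) hs))
    have h2 := (IsPath.setIntegral_density_le hW0 hi (Icc (x + 1) (x + 1 + l))).trans hC
    rw [add_sub_cancel_left] at this
    linarith
  · have := IsPath.mul_le_integral_density hi (a := x - 1 - l) (b := x - 1) (c := c) (by linarith)
      fun y hy => hR _ _ (hfar y (by rw [abs_of_nonpos] <;> linarith [hy.1, hy.2])
        (by rw [abs_of_nonpos] <;> linarith [hy.2])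
        (mul_nonneg_of_nonpos_of_nonpos (by linarith [hy.2]) hs))
    have h2 := (IsPath.setIntegral_density_le hW0 hi (Icc (x - 1 - l) (x - 1))).trans hC
    rw [sub_sub_cancel] at this
    linarith

/-- A path with bounds on its energy, position and velocity. -/
structure IsBoundedPath (W : Vec m → Vec m → ℝ) (C B M : ℝ) (u v w : ℝ → Vec m) : Prop where
  path : IsPath u v w
  integrable : Integrable (density W u v w)
  integral_le : ∫ x, density W u v w x ≤ C
  pos_le : ∀ x, ‖u x‖ ≤ B
  vel_le : ∀ x, ‖v x‖ ≤ M

/-- With the velocity bounded by `M`, a path at distance more than `|R| + M * l` from the origin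
needs a time `l` to return to radius `R`, and spends too much energy meanwhile. -/
theorem exists_isBoundedPath (hW0 : ∀ u v, 0 ≤ W u v) (h3 : HypH3 W) (C : ℝ) :
    ∃ B M : ℝ, 0 < B ∧ 0 < M ∧ ∀ u v w : ℝ → Vec m, IsPath u v w →
      Integrable (density W u v w) → ∫ x, density W u v w x ≤ C → IsBoundedPath W C B M u v w := by
  obtain ⟨M, hM0, hM⟩ := exists_velocity_bound hW0 h3 C
  obtain ⟨c, hc, R, hR⟩ := h3
  set l : ℝ := |C| / c + 1 with hl
  have hl0 : 0 < l := by positivity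
  have hcl : C < c * l := by
    have : c * l = |C| + c := by rw [hl]; field_simp
    linarith [le_abs_self C]
  refine ⟨|R| + M * l, M, by positivity, hM0, fun u v w h hi hC => ⟨h, hi, hC, fun x => ?_,
    hM u v w h hi hC⟩⟩
  by_contra! hB
  have hfar : ∀ y ∈ Icc x (x + l), R ≤ ‖u y‖ := fun y hy => by
    have h1 := norm_sub_sub_smul_le (x := x) (y := y) (a := (0 : Vec m)) (D := M) h.hasDerivAt
      fun t _ => by simpa using hM u v w h hi hC t
    rw [smul_zero, sub_zero, abs_of_nonneg (by linarith [hy.1])] at h1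
    have h2 : M * (y - x) ≤ M * l := by gcongr; linarith [hy.2]
    have h3 := norm_sub_norm_le (u x) (u y)
    rw [norm_sub_rev] at h3
    linarith [le_abs_self R]
  have := IsPath.mul_le_integral_density hi (a := x) (b := x + l) (c := c) (by linarith)
    fun y hy => hR _ _ (hfar y hy)
  have h2 := (IsPath.setIntegral_density_le hW0 hi (Icc x (x + l))).trans hC
  rw [add_sub_cancel_left] at this
  linarith

namespace IsBoundedPath

variable {B M : ℝ}

theorem comp_add (h : IsBoundedPath W C B M u v w) (y : ℝ) :
    IsBoundedPath W C B M (fun x => u (x + y)) (fun x => v (x + y)) (fun x => w (x + y)) where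
  path := h.path.comp_add y
  integrable := h.integrable.comp_add_right y
  integral_le := (integral_add_right_eq_self (density W u v w) y).trans_le h.integral_le
  pos_le _ := h.pos_le _
  vel_le _ := h.vel_le _

theorem mem_prod (h : IsBoundedPath W C B M u v w) (x : ℝ) :
    (u x, v x) ∈ Metric.closedBall (0 : Vec m) B ×ˢ Metric.closedBall (0 : Vec m) M :=
  ⟨by simpa using h.pos_le x, by simpa using h.vel_le x⟩

theorem dist_pos_le (h : IsBoundedPath W C B M u v w) {x y : ℝ} (hxy : x ≤ y) :
    dist (u x) (u y) ≤ M * (y - x) := by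
  have h1 := norm_sub_sub_smul_le (x := x) (y := y) (a := (0 : Vec m)) (D := M) h.path.hasDerivAt
    fun t _ => by simpa using h.vel_le t
  rwa [smul_zero, sub_zero, abs_of_nonneg (by linarith), ← dist_eq_norm, dist_comm] at h1

end IsBoundedPath

theorem isCompact_prod_closedBall (B M : ℝ) :
    IsCompact (Metric.closedBall (0 : Vec m) B ×ˢ Metric.closedBall (0 : Vec m) M) :=
  (isCompact_closedBall _ _).prod (isCompact_closedBall _ _)

/-- The potential has a common modulus of continuity along all paths with the same bounds. -/
theorem exists_modulus (hW : Continuous fun p : Vec m × Vec m => W p.1 p.2)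
    (hW0 : ∀ u v, 0 ≤ W u v) {B M : ℝ} (hM : 0 < M) {ε : ℝ} (hε : 0 < ε) :
    ∃ η : ℝ, 0 < η ∧ ∀ u v w : ℝ → Vec m, IsBoundedPath W C B M u v w → ∀ x y, x ≤ y → y ≤ x + η →
      |W (u y) (v y) - W (u x) (v x)| < ε := by
  have huc := (isCompact_prod_closedBall (m := m) B M).uniformContinuousOn_of_continuous
    hW.continuousOn
  obtain ⟨r, hr, hu⟩ := Metric.uniformContinuousOn_iff.1 huc ε hε
  -- This weight makes the energy term of the velocity oscillation less than `r / 4`; the window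
  -- length is then chosen to make the other term at most `r / 4`.
  set k : ℝ := 4 * (|C| + 1) / r with hk
  have hk0 : 0 < k := by positivity
  refine ⟨min (r / (2 * M)) (r / (2 * k)), by positivity, fun u v w h x y hxy hy => ?_⟩
  have hy1 : y - x ≤ r / (2 * M) := by linarith [min_le_left (r / (2 * M)) (r / (2 * k))]
  have hy2 : y - x ≤ r / (2 * k) := by linarith [min_le_right (r / (2 * M)) (r / (2 * k))]
  have h1 := h.path.norm_velocity_sub_le hW0 h.integrable hxy hk0
  have h2 := (IsPath.setIntegral_density_le hW0 h.integrable (Icc x y)).trans h.integral_le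
  have h3 : k * (y - x) / 2 ≤ r / 4 := by
    have : k * (y - x) ≤ k * (r / (2 * k)) := by gcongr
    have h' : k * (r / (2 * k)) = r / 2 := by field_simp
    linarith
  have h4 : (∫ t in Icc x y, density W u v w t) / k < r / 4 := by
    rw [div_lt_iff₀ hk0]
    have : r / 4 * k = |C| + 1 := by rw [hk]; field_simp
    linarith [le_abs_self C]
  have h5 : dist (u x) (u y) < r := by
    refine (h.dist_pos_le hxy).trans_lt ?_
    have : M * (y - x) ≤ M * (r / (2 * M)) := by gcongr
    have h' : M * (r / (2 * M)) = r / 2 := by field_simp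
    linarith
  have h6 : dist (v x) (v y) < r := by
    rw [dist_comm, dist_eq_norm]
    linarith
  have := hu _ (h.mem_prod x) _ (h.mem_prod y) (max_lt h5 h6)
  rwa [Real.dist_eq, abs_sub_comm] at this

/-- Each visit of a bounded path to the boundary of `Ω` costs a fixed amount of energy. -/
theorem exists_crossing_cost (hW : Continuous fun p : Vec m × Vec m => W p.1 p.2)
    (hW0 : ∀ u v, 0 ≤ W u v) {Ω : Set (Vec m)} (hΩ : ∀ u ∈ frontier Ω, ∀ v, 0 < W u v)
    {B M : ℝ} (hM : 0 < M) :
    ∃ η δ : ℝ, 0 < η ∧ 0 < δ ∧ ∀ u v w : ℝ → Vec m, IsBoundedPath W C B M u v w → ∀ x,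
      u x ∈ frontier Ω → δ ≤ ∫ t in Icc x (x + η), density W u v w t := by
  have hK : IsCompact ((Metric.closedBall (0 : Vec m) B ∩ frontier Ω) ×ˢ
      Metric.closedBall (0 : Vec m) M) :=
    ((isCompact_closedBall _ _).inter_right isClosed_frontier).prod (isCompact_closedBall _ _)
  -- Positivity on `∂Ω` is not uniform in the velocity; the bounds `B` and `M` restrict to a compact
  -- set, where it is.
  obtain ⟨d, hd, hdW⟩ : ∃ d : ℝ, 0 < d ∧ ∀ p ∈ (Metric.closedBall (0 : Vec m) B ∩ frontier Ω) ×ˢ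
      Metric.closedBall (0 : Vec m) M, d ≤ W p.1 p.2 := by
    rcases eq_empty_or_nonempty ((Metric.closedBall (0 : Vec m) B ∩ frontier Ω) ×ˢ
      Metric.closedBall (0 : Vec m) M) with he | hne
    · exact ⟨1, one_pos, by simp [he]⟩
    · obtain ⟨p, hp, hmin⟩ := hK.exists_isMinOn hne hW.continuousOn
      exact ⟨W p.1 p.2, hΩ _ hp.1.2 _, fun p' hp' => hmin hp'⟩
  obtain ⟨η, hη, hmod⟩ := exists_modulus (C := C) hW hW0 (B := B) hM (half_pos hd)
  refine ⟨η, d / 2 * η, hη, by positivity, fun u v w h x hx => ?_⟩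
  have := IsPath.mul_le_integral_density h.integrable (a := x) (b := x + η) (c := d / 2)
    (by linarith) fun y hy => by
      have h1 := abs_lt.1 (hmod u v w h x y hy.1 hy.2)
      have h2 := hdW (u x, v x) ⟨⟨(h.mem_prod x).1, hx⟩, (h.mem_prod x).2⟩
      simp only at h2
      linarith [h1.1]
  rwa [add_sub_cancel_left] at this

/-- A bounded path makes a bounded number of well separated visits to the boundary of `Ω`. -/
theorem exists_card_crossing_le (hW : Continuous fun p : Vec m × Vec m => W p.1 p.2)
    (hW0 : ∀ u v, 0 ≤ W u v) {Ω : Set (Vec m)} (hΩ : ∀ u ∈ frontier Ω, ∀ v, 0 < W u v)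
    {B M : ℝ} (hM : 0 < M) :
    ∃ (η : ℝ) (N : ℕ), ∀ u v w : ℝ → Vec m, IsBoundedPath W C B M u v w →
      ∀ F : Finset ℝ, (∀ x ∈ F, u x ∈ frontier Ω) →
        (∀ x ∈ F, ∀ y ∈ F, x ≠ y → η < |x - y|) → F.card ≤ N := by
  obtain ⟨η, δ, hη, hδ, hcost⟩ := exists_crossing_cost (C := C) hW hW0 hΩ (B := B) hM
  obtain ⟨N, hN⟩ := exists_nat_ge (C / δ)
  refine ⟨η, N, fun u v w h F hF hsep => ?_⟩
  -- Visits more than `η` apart have disjoint energy windows, so their costs add up to at most `C`.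
  have hdisj : (F : Set ℝ).Pairwise (Function.onFun Disjoint fun x => Icc x (x + η)) := by
    intro x hx y hy hxy
    refine Set.disjoint_left.2 fun t ht ht' => ?_
    have := hsep x hx y hy hxy
    rcases le_total x y with h' | h'
    · rw [abs_of_nonpos (by linarith)] at this
      linarith [ht.2, ht'.1]
    · rw [abs_of_nonneg (by linarith)] at this
      linarith [ht.1, ht'.2]
  have h1 := integral_biUnion_finset F (fun _ _ => measurableSet_Icc) hdisj
    (f := density W u v w) (μ := volume) (fun _ _ => h.integrable.integrableOn)
  have h2 : (F.card : ℝ) * δ ≤ ∑ x ∈ F, ∫ t in Icc x (x + η), density W u v w t := by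
    rw [← nsmul_eq_mul]
    exact Finset.card_nsmul_le_sum _ _ _ fun x hx => hcost u v w h x (hF x hx)
  rw [← h1] at h2
  have h3 := h2.trans ((IsPath.setIntegral_density_le hW0 h.integrable _).trans h.integral_le)
  rw [← le_div_iff₀ hδ] at h3
  exact_mod_cast h3.trans hN

end

/-! ### Locating the transition -/

/-- Sets of reals with a bounded number of well separated points cluster, infinitely often, at
arbitrarily distant centres. -/
theorem exists_cluster_centres {Z : ℕ → Set ℝ} (hne : ∀ n, (Z n).Nonempty) {η : ℝ} {N : ℕ}
    (hN : ∀ n, ∀ F : Finset ℝ, (∀ x ∈ F, x ∈ Z n) →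
      (∀ x ∈ F, ∀ y ∈ F, x ≠ y → η < |x - y|) → F.card ≤ N) :
    ∃ L : ℝ, 0 ≤ L ∧ ∀ T : ℝ, ∃ᶠ n in atTop, ∃ F : Finset ℝ, F.Nonempty ∧
      (∀ x ∈ F, ∀ y ∈ F, x ≠ y → T < |x - y|) ∧ ∀ z ∈ Z n, ∃ x ∈ F, |z - x| ≤ L := by
  classical
  -- The number `K` of points is taken maximal among those for which infinitely many of the sets
  -- have `K` points at arbitrarily large mutual distance.
  let P : ℕ → Prop := fun K => ∀ T : ℝ, ∃ᶠ n in atTop, ∃ F : Finset ℝ, F.card = K ∧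
    (∀ x ∈ F, x ∈ Z n) ∧ ∀ x ∈ F, ∀ y ∈ F, x ≠ y → T < |x - y|
  have h1 : P 1 := fun T => Frequently.of_forall fun n => by
    obtain ⟨z, hz⟩ := hne n
    exact ⟨{z}, by simp, by simpa using hz, by simp⟩
  have hle : ∀ K, P K → K ≤ N := fun K hK => by
    obtain ⟨n, F, hF, hFZ, hs⟩ := (hK η).exists
    exact hF ▸ hN n F hFZ hs
  set K := Nat.findGreatest P N with hKdef
  have hK : P K := Nat.findGreatest_spec (hle 1 h1) h1
  have hK1 : 1 ≤ K := Nat.le_findGreatest (hle 1 h1) h1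
  have hnot : ¬ P (K + 1) := fun h => by
    have := Nat.le_findGreatest (hle _ h) h
    omega
  simp only [P, not_forall, not_frequently] at hnot
  -- By maximality, `K + 1` points at mutual distance above `T₀` eventually do not occur. A point
  -- far from all `K` centres would be such an extra point.
  obtain ⟨T₀, hT₀⟩ := hnot
  refine ⟨max T₀ 0, le_max_right _ _, fun T => ?_⟩
  refine ((hK (max T (max T₀ 0))).and_eventually hT₀).mono ?_
  rintro n ⟨⟨F, hF, hFZ, hs⟩, hn⟩
  refine ⟨F, Finset.card_pos.1 (by omega), fun x hx y hy hxy =>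
    (le_max_left _ _).trans_lt (hs x hx y hy hxy), fun z hz => ?_⟩
  by_contra! hfar
  have hzF : z ∉ F := fun h => by
    have := hfar z h
    simp at this
  have hfar' : ∀ x ∈ F, T₀ < |z - x| := fun x hx => (le_max_left _ _).trans_lt (hfar x hx)
  refine hn ⟨insert z F, by rw [Finset.card_insert_of_notMem hzF, hF], ?_, ?_⟩
  · simp only [Finset.mem_insert, forall_eq_or_imp]
    exact ⟨hz, hFZ⟩
  · intro x hx y hy hxy
    rw [Finset.mem_insert] at hx hy
    rcases hx with rfl | hx <;> rcases hy with rfl | hy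
    · exact absurd rfl hxy
    · exact hfar' y hy
    · rw [abs_sub_comm]; exact hfar' x hx
    · exact ((le_max_left _ _).trans (le_max_right _ _)).trans_lt (hs x hx y hy hxy)

/-- Off the frontier, `Ω` and the exterior of its closure form a separation by open sets, which a
connected image cannot cross. -/
theorem mem_iff_of_forall_notMem_frontier {X : Type*} [TopologicalSpace X] {Ω : Set X}
    (hΩ : IsOpen Ω) {u : ℝ → X} (hu : Continuous u) {x y : ℝ}
    (h : ∀ t ∈ uIcc x y, u t ∉ frontier Ω) : u x ∈ Ω ↔ u y ∈ Ω := by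
  have hs : u '' uIcc x y ⊆ Ω ∪ (closure Ω)ᶜ := by
    rintro _ ⟨t, ht, rfl⟩
    by_cases hc : u t ∈ closure Ω
    · left
      by_contra hn
      exact h t ht ⟨hc, by rwa [hΩ.interior_eq]⟩
    · right; exact hc
  have hd : Disjoint Ω (closure Ω)ᶜ := disjoint_compl_right.mono_left subset_closure
  have hp : IsPreconnected (u '' uIcc x y) := isPreconnected_uIcc.image u hu.continuousOn
  have hx : u x ∈ u '' uIcc x y := mem_image_of_mem u left_mem_uIcc
  have hy : u y ∈ u '' uIcc x y := mem_image_of_mem u right_mem_uIcc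
  exact ⟨fun h' => hp.subset_left_of_subset_union hΩ isClosed_closure.isOpen_compl hd hs
    ⟨_, hx, h'⟩ hy, fun h' => hp.subset_left_of_subset_union hΩ isClosed_closure.isOpen_compl hd hs
    ⟨_, hy, h'⟩ hx⟩

/-- If all visits to the boundary of `Ω` take place near well separated centres, then the path
leaves `Ω` for a long time near one of them. -/
theorem exists_transition {X : Type*} [TopologicalSpace X] {Ω : Set X}
    (hΩ : IsOpen Ω) {u : ℝ → X} (hu : Continuous u) {a b L T : ℝ} (ha : ∀ x ≤ a, u x ∈ Ω)
    (hb : ∀ x, b ≤ x → u x ∉ Ω) (hL : 0 ≤ L) (hT : 2 * L < T) {F : Finset ℝ} (hF : F.Nonempty)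
    (hsep : ∀ x ∈ F, ∀ y ∈ F, x ≠ y → T < |x - y|)
    (hcov : ∀ z, u z ∈ frontier Ω → ∃ x ∈ F, |z - x| ≤ L) :
    ∃ y, (∀ x ∈ Ioo (y - (T - L)) (y - L), u x ∈ Ω) ∧
      ∀ x ∈ Ioo (y + L) (y + (T - L)), u x ∉ Ω := by
  classical
  have hmove : ∀ {x y : ℝ}, (∀ t ∈ uIcc x y, ∀ f ∈ F, L < |t - f|) → (u x ∈ Ω ↔ u y ∈ Ω) :=
    fun h => mem_iff_of_forall_notMem_frontier hΩ hu fun t ht hfr => by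
      obtain ⟨f, hf, hle⟩ := hcov t hfr
      exact absurd (h t ht f hf) (not_lt.2 hle)
  have hsep' : ∀ x ∈ F, ∀ y ∈ F, x < y → T < y - x := fun x hx y hy hxy => by
    have := hsep y hy x hx hxy.ne'
    rwa [abs_of_pos (by linarith)] at this
  -- Between consecutive `L`-neighbourhoods of centres the side of `Ω` is constant, and `f + T / 2`
  -- samples the gap after `f`. The last centre belongs to `G`; the first member `y` of `G` is the
  -- transition, since the gap before it lies inside `Ω`.
  set G := F.filter fun f => u (f + T / 2) ∉ Ω with hG
  have hGne : G.Nonempty := by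
    refine ⟨F.max' hF, Finset.mem_filter.2 ⟨F.max'_mem hF, fun hin => ?_⟩⟩
    refine hb _ (le_max_left b (F.max' hF + T / 2)) ((hmove fun t ht f hf => ?_).1 hin)
    have h1 := F.le_max' f hf
    rw [uIcc_of_le (le_max_right _ _)] at ht
    rw [abs_of_pos] <;> linarith [ht.1]
  set y := G.min' hGne with hy
  have hyG : y ∈ G := G.min'_mem hGne
  obtain ⟨hyF, hyout⟩ := Finset.mem_filter.1 hyG
  refine ⟨y, fun x hx => ?_, fun x hx hin => hyout ((hmove fun t ht f hf => ?_).1 hin)⟩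
  · by_cases hlow : (F.filter fun f => f < y).Nonempty
    · set z := (F.filter fun f => f < y).max' hlow with hz
      obtain ⟨hzF, hzy⟩ := Finset.mem_filter.1 ((F.filter fun f => f < y).max'_mem hlow)
      rw [← hz] at hzF hzy
      have hgap := hsep' z hzF y hyF hzy
      have hzin : u (z + T / 2) ∈ Ω := by
        by_contra hn
        exact absurd (G.min'_le z (Finset.mem_filter.2 ⟨hzF, hn⟩)) (not_le.2 hzy)
      refine (hmove fun t ht f hf => ?_).1 hzin
      have ht' : z + L < t ∧ t < y - L := by
        rw [mem_uIcc] at ht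
        rcases ht with ht | ht <;> constructor <;> linarith [ht.1, ht.2, hx.1, hx.2]
      rcases lt_or_ge f y with hfy | hfy
      · have := (F.filter fun f => f < y).le_max' f (Finset.mem_filter.2 ⟨hf, hfy⟩)
        rw [← hz] at this
        rw [abs_of_pos] <;> linarith
      · rw [abs_of_neg] <;> linarith
    · refine (hmove fun t ht f hf => ?_).1 (ha _ (min_le_left a x))
      rw [uIcc_of_le (min_le_right _ _)] at ht
      have hfy : y ≤ f := by
        by_contra! hn
        exact hlow ⟨f, Finset.mem_filter.2 ⟨hf, hn⟩⟩
      rw [abs_of_neg] <;> linarith [ht.2, hx.2]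
  · have ht' : y + L < t ∧ t < y + (T - L) := by
      rw [mem_uIcc] at ht
      rcases ht with ht | ht <;> constructor <;> linarith [ht.1, ht.2, hx.1, hx.2]
    rcases lt_trichotomy f y with hfy | hfy | hfy
    · have := hsep' f hf y hyF hfy
      rw [abs_of_pos] <;> linarith
    · rw [abs_of_pos] <;> linarith
    · have := hsep' y hyF f hf hfy
      rw [abs_of_neg] <;> linarith

/-! ### Compactness and lower semicontinuity -/

/-- Bounded sequences in a separable Hilbert space have weakly convergent subsequences. -/
theorem exists_weak_subseq {H : Type*} [NormedAddCommGroup H] [InnerProductSpace ℝ H]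
    [CompleteSpace H] [TopologicalSpace.SeparableSpace H] {f : ℕ → H} {r : ℝ}
    (hf : ∀ n, ‖f n‖ ≤ r) :
    ∃ (g : H) (φ : ℕ → ℕ), StrictMono φ ∧
      ∀ z, Tendsto (fun n => inner ℝ (f (φ n)) z) atTop (𝓝 (inner ℝ g z)) := by
  -- Sequential Banach–Alaoglu in the dual, transported back by the Riesz isomorphism.
  have hmem : ∀ n, StrongDual.toWeakDual (InnerProductSpace.toDual ℝ H (f n)) ∈
      WeakDual.toStrongDual ⁻¹' Metric.closedBall (0 : StrongDual ℝ H) r := fun n => by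
    simpa using hf n
  obtain ⟨l, -, φ, hφ, hl⟩ := WeakDual.isSeqCompact_closedBall ℝ H 0 r hmem
  refine ⟨(InnerProductSpace.toDual ℝ H).symm (WeakDual.toStrongDual l), φ, hφ, fun z => ?_⟩
  have := ((WeakDual.eval_continuous (𝕜 := ℝ) z).tendsto l).comp hl
  simpa using! this

theorem tendsto_of_forall_inner {ι : Type*} {l : Filter ι} {f : ι → Vec m} {a : Vec m}
    (h : ∀ e : Vec m, Tendsto (fun i => inner ℝ e (f i)) l (𝓝 (inner ℝ e a))) :
    Tendsto f l (𝓝 a) := by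
  set b := EuclideanSpace.basisFun (Fin m) ℝ
  have h1 : Tendsto (fun i => ∑ j, inner ℝ (b j) (f i) • b j) l
      (𝓝 (∑ j, inner ℝ (b j) a • b j)) :=
    tendsto_finsetSum _ fun j _ => (h (b j)).smul_const _
  simpa only [b.sum_repr'] using h1

/-- Integrals over bounded intervals are pairings with vector-valued indicators, so weak convergence
of accelerations gives pointwise convergence of velocities. -/
theorem inner_setIntegral_eq_inner_toLp {w : ℝ → Vec m} (hw : MemLp w 2 volume) (e : Vec m)
    (x y : ℝ) :
    inner ℝ e (∫ t in Ioc x y, w t) =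
      inner ℝ (hw.toLp w) (indicatorConstLp 2 (measurableSet_Ioc (a := x) (b := y))
        (by simp : volume (Ioc x y) ≠ ⊤) e) := by
  rw [real_inner_comm _ (hw.toLp w), L2.inner_indicatorConstLp_eq_inner_setIntegral ℝ]
  congr 1
  refine integral_congr_ae (ae_restrict_of_ae ?_)
  filter_upwards [hw.coeFn_toLp] with t ht
  exact ht.symm

theorem tendsto_intervalIntegral_of_weak {w : ℕ → ℝ → Vec m} {w' : ℝ → Vec m}
    (hw : ∀ n, MemLp (w n) 2 volume) (hw' : MemLp w' 2 volume)
    (h : ∀ z, Tendsto (fun n => inner ℝ ((hw n).toLp (w n)) z) atTop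
      (𝓝 (inner ℝ (hw'.toLp w') z))) (x : ℝ) :
    Tendsto (fun n => ∫ t in (0 : ℝ)..x, w n t) atTop (𝓝 (∫ t in (0 : ℝ)..x, w' t)) := by
  refine tendsto_of_forall_inner fun e => ?_
  simp only [intervalIntegral, inner_sub_right, inner_setIntegral_eq_inner_toLp hw',
    inner_setIntegral_eq_inner_toLp (hw _)]
  exact (h _).sub (h _)

theorem inner_toLp {w w' : ℝ → Vec m} (hw : MemLp w 2 volume) (hw' : MemLp w' 2 volume) :
    inner ℝ (hw.toLp w) (hw'.toLp w') = ∫ x, inner ℝ (w x) (w' x) := by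
  rw [L2.inner_def]
  refine integral_congr_ae ?_
  filter_upwards [hw.coeFn_toLp, hw'.coeFn_toLp] with t h1 h2
  rw [h1, h2]

theorem inner_toLp_self {w : ℝ → Vec m} (hw : MemLp w 2 volume) :
    inner ℝ (hw.toLp w) (hw.toLp w) = 2 * ∫ x, 1 / 2 * ‖w x‖ ^ 2 := by
  rw [inner_toLp, ← integral_const_mul]
  refine integral_congr_ae (Eventually.of_forall fun x => ?_)
  simp only [real_inner_self_eq_norm_sq]
  ring

/-- The two parts need different semicontinuity arguments: weak convergence for the quadratic part
and Fatou's lemma for the potential. -/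
theorem IsPath.action_eq_add {u v w : ℝ → Vec m} {W : Vec m → Vec m → ℝ} (h : IsPath u v w)
    (hW0 : ∀ u v, 0 ≤ W u v) :
    action W u v w = ENNReal.ofReal (∫ x, 1 / 2 * ‖w x‖ ^ 2)
      + ∫⁻ x, ENNReal.ofReal (W (u x) (v x)) := by
  rw [ofReal_integral_eq_lintegral_ofReal h.integrable_sq
    (Eventually.of_forall fun x => by positivity), ← lintegral_add_left']
  · exact lintegral_congr fun x => ENNReal.ofReal_add (by positivity) (hW0 _ _)
  · exact h.integrable_sq.1.aemeasurable.ennreal_ofReal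

/-- Sequences of paths with common bounds have a limit path, whose energy does not exceed
the limit of the energies. -/
theorem exists_limit_path {W : Vec m → Vec m → ℝ}
    (hW : Continuous fun p : Vec m × Vec m => W p.1 p.2) (hW0 : ∀ u v, 0 ≤ W u v) {C B M : ℝ}
    {u v w : ℕ → ℝ → Vec m} (h : ∀ n, IsBoundedPath W C B M (u n) (v n) (w n)) {E : ℝ}
    (hE : ∀ ε > 0, ∀ᶠ n in atTop, ∫ x, density W (u n) (v n) (w n) x ≤ E + ε) :
    ∃ (φ : ℕ → ℕ) (u' v' w' : ℝ → Vec m), StrictMono φ ∧ IsPath u' v' w' ∧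
      (∀ x, Tendsto (fun n => u (φ n) x) atTop (𝓝 (u' x))) ∧
      action W u' v' w' ≤ ENNReal.ofReal E := by
  have hL := fun n => (h n).path.memLp
  have hpot : ∀ n, Integrable fun x => W (u n x) (v n x) := fun n =>
    ((h n).integrable.sub (h n).path.integrable_sq).congr
      (Eventually.of_forall fun x => by simp [density])
  have hsum : ∀ n, ∫ x, density W (u n) (v n) (w n) x
      = (∫ x, 1 / 2 * ‖w n x‖ ^ 2) + ∫ x, W (u n x) (v n x) := fun n =>
    integral_add (h n).path.integrable_sq (hpot n)
  have hpot0 : ∀ n, 0 ≤ ∫ x, W (u n x) (v n x) := fun n => integral_nonneg fun x => hW0 _ _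
  have hnorm : ∀ n, ‖(hL n).toLp (w n)‖ ≤ Real.sqrt (2 * C) := fun n => by
    refine Real.le_sqrt_of_sq_le ?_
    rw [← real_inner_self_eq_norm_sq, inner_toLp_self]
    linarith [hpot0 n, hsum n, (h n).integral_le]
  have : Fact ((2 : ℝ≥0∞) ≠ ⊤) := ⟨ENNReal.ofNat_ne_top⟩
  obtain ⟨g, φ₁, hφ₁, hg⟩ := exists_weak_subseq hnorm
  obtain ⟨⟨a, b⟩, -, φ₂, hφ₂, hab⟩ := (isCompact_prod_closedBall (m := m) B M).tendsto_subseq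
    fun n => (h (φ₁ n)).mem_prod 0
  set φ := φ₁ ∘ φ₂ with hφ
  have ha : Tendsto (fun n => u (φ n) 0) atTop (𝓝 a) := (continuous_fst.tendsto _).comp hab
  have hb : Tendsto (fun n => v (φ n) 0) atTop (𝓝 b) := (continuous_snd.tendsto _).comp hab
  set w' : ℝ → Vec m := ⇑g with hw'
  have hw'L : MemLp w' 2 volume := Lp.memLp g
  have hgw : hw'L.toLp w' = g := Lp.toLp_coeFn g _
  have hweak : ∀ z, Tendsto (fun n => inner ℝ ((hL (φ n)).toLp (w (φ n))) z) atTop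
      (𝓝 (inner ℝ (hw'L.toLp w') z)) := fun z => by
    rw [hgw]; exact (hg z).comp hφ₂.tendsto_atTop
  have hwloc : LocallyIntegrable w' :=
    MemL2loc.locallyIntegrable fun K _ => hw'L.restrict K
  set v' : ℝ → Vec m := fun x => b + ∫ t in (0 : ℝ)..x, w' t with hv'
  have hv'c : Continuous v' := continuous_const.add (continuous_primitive hwloc)
  set u' : ℝ → Vec m := fun x => a + ∫ t in (0 : ℝ)..x, v' t with hu'
  have hpath : IsPath u' v' w' :=
    ⟨hasDerivAt_add_primitive hv'c a, fun x => by simp [hv'], hw'L⟩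
  have hvlim : ∀ x, Tendsto (fun n => v (φ n) x) atTop (𝓝 (v' x)) := fun x => by
    simp_rw [fun n => (h (φ n)).path.velocity_eq x]
    exact hb.add (tendsto_intervalIntegral_of_weak (fun n => hL (φ n)) hw'L hweak x)
  have hulim : ∀ x, Tendsto (fun n => u (φ n) x) atTop (𝓝 (u' x)) := fun x => by
    simp_rw [fun n => (h (φ n)).path.eq_add_integral x]
    refine ha.add (intervalIntegral.tendsto_integral_filter_of_dominated_convergence (fun _ => M)
      (Eventually.of_forall fun n =>
        (h (φ n)).path.continuous_velocity.aestronglyMeasurable)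
      (Eventually.of_forall fun n => Eventually.of_forall fun t _ => (h (φ n)).vel_le t)
      intervalIntegrable_const (Eventually.of_forall fun t _ => hvlim t))
  refine ⟨φ, u', v', w', hφ₁.comp hφ₂, hpath, hulim, ?_⟩
  set Q := ∫ x, 1 / 2 * ‖w' x‖ ^ 2 with hQ
  have hclaim : ∀ ε > 0, action W u' v' w' ≤ ENNReal.ofReal (E + 2 * ε) := fun ε hε => by
    have hQn : ∀ᶠ n in atTop, Q - ε ≤ ∫ x, 1 / 2 * ‖w (φ n) x‖ ^ 2 := by
      have h1 := hweak (hw'L.toLp w')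
      rw [inner_toLp_self] at h1
      filter_upwards [h1.eventually_const_le (show 2 * Q - ε < 2 * Q by linarith)] with n hn
      -- Expanding this square bounds the quadratic energy from below by the pairing with the weak
      -- limit, which converges.
      have h2 : 0 ≤ ‖(hL (φ n)).toLp (w (φ n)) - hw'L.toLp w'‖ ^ 2 := by positivity
      rw [norm_sub_sq_real, ← real_inner_self_eq_norm_sq, ← real_inner_self_eq_norm_sq,
        inner_toLp_self, inner_toLp_self] at h2
      linarith
    have hev : ∀ᶠ n in atTop, ∫ x, W (u (φ n) x) (v (φ n) x) ≤ E + 2 * ε - Q := by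
      filter_upwards [hQn, (hφ₁.comp hφ₂).tendsto_atTop.eventually (hE ε hε)] with n h1 h2
      have h3 := hsum (φ n)
      simp only [hφ, Function.comp_apply] at h1 h2 h3 ⊢
      linarith
    have hEQ : 0 ≤ E + 2 * ε - Q := by
      obtain ⟨n, hn⟩ := hev.exists
      exact (hpot0 _).trans hn
    have hlow : ∫⁻ x, ENNReal.ofReal (W (u' x) (v' x)) ≤ ENNReal.ofReal (E + 2 * ε - Q) := by
      have hlim : ∀ x, liminf (fun n => ENNReal.ofReal (W (u (φ n) x) (v (φ n) x))) atTop
          = ENNReal.ofReal (W (u' x) (v' x)) := fun x =>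
        (ENNReal.tendsto_ofReal ((hW.tendsto (u' x, v' x)).comp
          ((hulim x).prodMk_nhds (hvlim x)))).liminf_eq
      simp_rw [← hlim]
      refine (lintegral_liminf_le fun n => ?_).trans ?_
      · exact ((h (φ n)).path.continuous_potential hW).measurable.ennreal_ofReal
      · refine (liminf_le_liminf (hev.mono fun n hn => ?_)).trans
          (liminf_const (f := (atTop : Filter ℕ)) (ENNReal.ofReal (E + 2 * ε - Q))).le
        rw [← ofReal_integral_eq_lintegral_ofReal (hpot _) (Eventually.of_forall fun x => hW0 _ _)]
        exact ENNReal.ofReal_le_ofReal hn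
    rw [hpath.action_eq_add hW0]
    refine (add_le_add_right hlow _).trans ?_
    rw [← ENNReal.ofReal_add (integral_nonneg fun x => by positivity) hEQ]
    exact ENNReal.ofReal_le_ofReal (by linarith)
  have hlim : Tendsto (fun ε : ℝ => ENNReal.ofReal (E + 2 * ε)) (𝓝[>] 0)
      (𝓝 (ENNReal.ofReal E)) := by
    have hc : Continuous fun ε : ℝ => ENNReal.ofReal (E + 2 * ε) :=
      ENNReal.continuous_ofReal.comp (by fun_prop)
    have := (hc.tendsto 0).mono_left (nhdsWithin_le_nhds (s := Ioi 0))
    simpa using this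
  exact ge_of_tendsto hlim (eventually_mem_nhdsWithin.mono fun ε hε => hclaim ε hε)

/-! ### Behaviour at infinity -/

/-- The integral of an integrable function over a window tends to zero as the window moves off
to infinity. -/
theorem tendsto_integral_window {f : ℝ → ℝ} (hf : Integrable f) (s : ℝ) :
    Tendsto (fun x => ∫ t in Icc x (x + s), f t) (cocompact ℝ) (𝓝 0) := by
  have h0 : (0 : ℝ) = ∫ _ : ℝ, (0 : ℝ) := by simp
  simp_rw [← integral_indicator measurableSet_Icc]
  rw [h0]
  have : (cocompact ℝ).IsCountablyGenerated := by
    rw [cocompact_eq_atBot_atTop]; infer_instance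
  refine tendsto_integral_filter_of_dominated_convergence (fun t => ‖f t‖)
    (Eventually.of_forall fun x => hf.1.indicator measurableSet_Icc)
    (Eventually.of_forall fun x => Eventually.of_forall fun t => norm_indicator_le_norm_self _ _)
    hf.norm (Eventually.of_forall fun t => ?_)
  -- A fixed `t` lies in the window only for `x` in the compact set `Icc (t - s) t`.
  refine tendsto_const_nhds.congr' ?_
  have : (Icc (t - s) t)ᶜ ∈ cocompact ℝ := isCompact_Icc.compl_mem_cocompact
  filter_upwards [this] with x hx
  rw [indicator_of_notMem]
  exact fun h => hx ⟨by linarith [h.2], h.1⟩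

theorem eventually_cocompact_Icc {P : ℝ → Prop} (h : ∀ᶠ x in cocompact ℝ, P x) (s : ℝ) :
    ∀ᶠ x in cocompact ℝ, ∀ t ∈ Icc x (x + s), P t := by
  obtain ⟨K, hK, hKP⟩ := mem_cocompact.1 h
  obtain ⟨r, hr⟩ := hK.isBounded.subset_closedBall 0
  rw [Real.closedBall_eq_Icc, zero_sub, zero_add] at hr
  have : (Icc (-r - s) r)ᶜ ∈ cocompact ℝ := isCompact_Icc.compl_mem_cocompact
  filter_upwards [this] with x hx t ht
  refine hKP fun htK => hx ⟨?_, ?_⟩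
  · linarith [(hr htK).1, ht.2]
  · linarith [(hr htK).2, ht.1]

namespace IsBoundedPath

variable {u v w : ℝ → Vec m} {W : Vec m → Vec m → ℝ} {C B M : ℝ}

/-- On a long window the mean velocity is small because the position is bounded, and far out the
velocity hardly oscillates because the window carries little energy. -/
theorem tendsto_velocity (h : IsBoundedPath W C B M u v w) (hW0 : ∀ u v, 0 ≤ W u v) (hB : 0 < B) :
    Tendsto v (cocompact ℝ) (𝓝 0) := by
  rw [Metric.tendsto_nhds]
  intro ε hε
  -- The length `s` makes the displacement bound `2 * B` equal to `ε / 4 * s`; the weight `k` below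
  -- makes the oscillation at most `ε / 4`.
  set s : ℝ := 8 * B / ε with hs
  have hs0 : 0 < s := by positivity
  set k : ℝ := ε / (4 * s) with hk
  have hk0 : 0 < k := by positivity
  filter_upwards [(tendsto_integral_window h.integrable s).eventually_le_const
    (show 0 < k * (ε / 8) by positivity)] with x hx
  have hosc : ∀ t ∈ uIcc x (x + s), ‖v t - v x‖ ≤ ε / 4 := fun t ht => by
    rw [uIcc_of_le (by linarith)] at ht
    have h1 := h.path.norm_velocity_sub_le hW0 h.integrable ht.1 hk0
    have h2 : ∫ τ in Icc x t, density W u v w τ ≤ ∫ τ in Icc x (x + s), density W u v w τ :=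
      setIntegral_mono_set h.integrable.integrableOn
        (Eventually.of_forall fun τ => IsPath.density_nonneg hW0 τ)
        (Icc_subset_Icc_right ht.2).eventuallyLE
    have h3 : (∫ τ in Icc x t, density W u v w τ) / k ≤ ε / 8 := by
      rw [div_le_iff₀ hk0]; linarith
    have h4 : k * (t - x) / 2 ≤ k * s / 2 := by
      gcongr; linarith [ht.2]
    have h5 : k * s / 2 = ε / 8 := by rw [hk]; field_simp; norm_num
    linarith
  have h1 := norm_sub_sub_smul_le h.path.hasDerivAt hosc
  rw [add_sub_cancel_left, abs_of_pos hs0] at h1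
  have h2 : ‖s • v x‖ ≤ B + B + ε / 4 * s := by
    have : s • v x = u (x + s) - u x - (u (x + s) - u x - s • v x) := by abel
    rw [this]
    refine (norm_sub_le _ _).trans (add_le_add ((norm_sub_le _ _).trans ?_) h1)
    exact add_le_add (h.pos_le _) (h.pos_le _)
  rw [norm_smul, Real.norm_of_nonneg hs0.le] at h2
  have h3 : B + B = ε / 4 * s := by rw [hs]; field_simp; norm_num
  rw [dist_zero_right]
  have h4 : s * ‖v x‖ ≤ s * (ε / 2) := by linarith
  linarith [le_of_mul_le_mul_left h4 hs0]

/-- By the common modulus of continuity, a value of at least `ε` persists as `ε / 2` on a window of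
fixed length, too costly far out. -/
theorem tendsto_potential (h : IsBoundedPath W C B M u v w)
    (hW : Continuous fun p : Vec m × Vec m => W p.1 p.2) (hW0 : ∀ u v, 0 ≤ W u v) (hM : 0 < M) :
    Tendsto (fun x => W (u x) (v x)) (cocompact ℝ) (𝓝 0) := by
  rw [Metric.tendsto_nhds]
  intro ε hε
  obtain ⟨η, hη, hmod⟩ := exists_modulus (C := C) hW hW0 (B := B) hM (half_pos hε)
  filter_upwards [(tendsto_integral_window h.integrable η).eventually_lt_const
    (show 0 < ε / 2 * η by positivity)] with x hx
  rw [Real.dist_eq, sub_zero, abs_of_nonneg (hW0 _ _)]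
  by_contra! hlt
  have := IsPath.mul_le_integral_density h.integrable (a := x) (b := x + η) (c := ε / 2)
    (by linarith) fun y hy => by
      have h1 := abs_lt.1 (hmod u v w h x y hy.1 hy.2)
      linarith [h1.1]
  rw [add_sub_cancel_left] at this
  linarith

/-- As the velocity vanishes, uniform continuity replaces `W (u x) (v x)` by `W (u x) 0`, which has
a positive minimum on the bounded positions at distance at least `ε` from `A`. -/
theorem tendsto_infDist (h : IsBoundedPath W C B M u v w)
    (hW : Continuous fun p : Vec m × Vec m => W p.1 p.2) (hW0 : ∀ u v, 0 ≤ W u v)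
    (hB : 0 < B) (hM : 0 < M) {A : Set (Vec m)} (hA : A = {u | W u 0 = 0}) :
    Tendsto (fun x => Metric.infDist (u x) A) (cocompact ℝ) (𝓝 0) := by
  rw [Metric.tendsto_nhds]
  intro ε hε
  have hWc : Continuous fun a : Vec m => W a 0 := hW.comp (Continuous.prodMk_left 0)
  have hK : IsCompact (Metric.closedBall (0 : Vec m) B ∩ {a | ε ≤ Metric.infDist a A}) :=
    (isCompact_closedBall _ _).inter_right
      (isClosed_le continuous_const (Metric.continuous_infDist_pt A))
  obtain ⟨d, hd, hdW⟩ : ∃ d : ℝ, 0 < d ∧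
      ∀ a ∈ Metric.closedBall (0 : Vec m) B ∩ {a | ε ≤ Metric.infDist a A}, d ≤ W a 0 := by
    rcases eq_empty_or_nonempty
      (Metric.closedBall (0 : Vec m) B ∩ {a | ε ≤ Metric.infDist a A}) with he | hne'
    · exact ⟨1, one_pos, by simp [he]⟩
    · obtain ⟨a, ha, hmin⟩ := hK.exists_isMinOn hne' hWc.continuousOn
      refine ⟨W a 0, lt_of_le_of_ne (hW0 _ _) fun h0 => ?_, fun p' hp' => hmin hp'⟩
      have haA : a ∈ A := by rw [hA]; exact h0.symm
      have := ha.2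
      rw [mem_ofPred_eq, Metric.infDist_zero_of_mem haA] at this
      linarith
  obtain ⟨r, hr, hu⟩ := Metric.uniformContinuousOn_iff.1
    ((isCompact_prod_closedBall (m := m) B M).uniformContinuousOn_of_continuous hW.continuousOn)
    (d / 2) (half_pos hd)
  filter_upwards [(h.tendsto_potential hW hW0 hM).eventually_lt_const (half_pos hd),
    Metric.tendsto_nhds.1 (h.tendsto_velocity hW0 hB) r hr] with x h1 h2
  rw [Real.dist_eq, sub_zero, abs_of_nonneg Metric.infDist_nonneg]
  by_contra! hlt
  have h3 := hdW (u x) ⟨(h.mem_prod x).1, hlt⟩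
  have h4 := hu _ (h.mem_prod x) (u x, 0) ⟨(h.mem_prod x).1, by simp [hM.le]⟩
    (max_lt (by simpa using hr) h2)
  rw [Real.dist_eq] at h4
  linarith [(abs_lt.1 h4).1]

end IsBoundedPath

/-- A continuous function vanishing on `A × {0}`, with `A` compact, tends to zero along maps
approaching `A × {0}`. -/
theorem tendsto_zero_of_tendsto_infDist {E F : Type*} [NormedAddCommGroup E] [NormedAddCommGroup F]
    {ι : Type*} {l : Filter ι} {G : E × E → F} (hG : Continuous G) {A : Set E} (hA : IsCompact A)
    (hne : A.Nonempty) (h0 : ∀ a ∈ A, G (a, 0) = 0) {u v : ι → E}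
    (hu : Tendsto (fun x => Metric.infDist (u x) A) l (𝓝 0)) (hv : Tendsto v l (𝓝 0)) :
    Tendsto (fun x => G (u x, v x)) l (𝓝 0) := by
  rw [Metric.tendsto_nhds]
  intro ε hε
  have hmem := (hA.prod (isCompact_singleton (x := (0 : E)))).uniformContinuousAt_of_continuousAt G
    (fun p _ => hG.continuousAt) (Metric.dist_mem_uniformity hε)
  obtain ⟨r, hr, hu'⟩ := Metric.mem_uniformity_dist.1 hmem
  filter_upwards [hu.eventually_lt_const hr, Metric.tendsto_nhds.1 hv r hr] with x h1 h2
  obtain ⟨a, ha, hda⟩ := hA.exists_infDist_eq_dist hne (u x)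
  have h3 : dist ((a, (0 : E))) (u x, v x) < r := by
    refine max_lt ?_ ?_
    · rwa [dist_comm, ← hda]
    · simpa only [dist_comm] using h2
  have h4 : dist (G (a, 0)) (G (u x, v x)) < ε := hu' h3 ⟨ha, rfl⟩
  rwa [h0 a ha, dist_comm] at h4

/-- If `v` tends to zero and the oscillation of `v''` on windows tends to zero, then `v'` and
`v''` tend to zero. -/
theorem tendsto_deriv_of_tendsto {E : Type*} [NormedAddCommGroup E] [NormedSpace ℝ E]
    {v w z : ℝ → E} (hv : ∀ x, HasDerivAt v (w x) x) (hw : ∀ x, HasDerivAt w (z x) x)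
    (h0 : Tendsto v (cocompact ℝ) (𝓝 0))
    (hz : ∀ ε > 0, ∀ᶠ x in cocompact ℝ, ∀ t ∈ Icc x (x + 2), ‖z t - z x‖ ≤ ε) :
    Tendsto w (cocompact ℝ) (𝓝 0) ∧ Tendsto z (cocompact ℝ) (𝓝 0) := by
  have key : ∀ ε > 0, ∀ᶠ x in cocompact ℝ, ‖w x‖ < ε ∧ ‖z x‖ < ε := fun ε hε => by
    have hδ : 0 < ε / 20 := by positivity
    filter_upwards [hz _ hδ, eventually_cocompact_Icc (Metric.tendsto_nhds.1 h0 _ hδ) 2]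
      with x hx hvx
    have hw1 : ∀ y ∈ Icc x (x + 2), ‖w y - w x - (y - x) • z x‖ ≤ 2 * (ε / 20) := fun y hy => by
      have h1 := norm_sub_sub_smul_le (x := x) (y := y) (a := z x) (D := ε / 20) hw fun t ht => by
        rw [uIcc_of_le hy.1] at ht
        exact hx t ⟨ht.1, ht.2.trans hy.2⟩
      rw [abs_of_nonneg (by linarith [hy.1])] at h1
      have : ε / 20 * (y - x) ≤ ε / 20 * 2 := by gcongr; linarith [hy.2]
      linarith
    have hv1 : ∀ y ∈ Icc x (x + 2),
        ‖v y - v x - ((y - x) ^ 2 / 2) • z x - (y - x) • w x‖ ≤ 4 * (ε / 20) := fun y hy => by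
      have h1 := norm_sub_sub_smul_le (u := fun t => v t - ((t - x) ^ 2 / 2) • z x)
        (v := fun t => w t - (t - x) • z x) (x := x) (y := y) (a := w x) (D := 2 * (ε / 20))
        (fun t => by
          have h1 : HasDerivAt (fun t : ℝ => (t - x) ^ 2 / 2) (t - x) t := by
            have := (((hasDerivAt_id t).sub_const x).pow 2).div_const 2
            simpa using! this
          exact (hv t).sub (h1.smul_const (z x)))
        fun t ht => by
          rw [uIcc_of_le hy.1] at ht
          have := hw1 t ⟨ht.1, ht.2.trans hy.2⟩
          rwa [sub_right_comm] at this
      rw [abs_of_nonneg (by linarith [hy.1])] at h1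
      have h2 : 2 * (ε / 20) * (y - x) ≤ 2 * (ε / 20) * 2 := by gcongr; linarith [hy.2]
      simp only [sub_self, ne_eq, OfNat.ofNat_ne_zero, not_false_eq_true, zero_pow, zero_div,
        zero_smul, sub_zero] at h1
      rw [sub_right_comm (v y)]
      linarith
    have e0 := hvx x ⟨le_rfl, by linarith⟩
    have e1 := hvx (x + 1) ⟨by linarith, by linarith⟩
    have e2 := hvx (x + 2) ⟨by linarith, le_rfl⟩
    have f1 := hv1 (x + 1) ⟨by linarith, by linarith⟩
    have f2 := hv1 (x + 2) ⟨by linarith, le_rfl⟩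
    rw [dist_zero_right] at e0 e1 e2
    rw [add_sub_cancel_left] at f1 f2
    set r₁ := v (x + 1) - v x - ((1 : ℝ) ^ 2 / 2) • z x - (1 : ℝ) • w x with hr₁
    set r₂ := v (x + 2) - v x - ((2 : ℝ) ^ 2 / 2) • z x - (2 : ℝ) • w x with hr₂
    -- Solve the two second-order Taylor formulas at `x + 1` and `x + 2` for the derivatives. The
    -- coefficients with the remainder bounds total `16` or less, so `ε / 20` suffices.
    have hzx : z x = v (x + 2) - (2 : ℝ) • v (x + 1) + v x - r₂ + (2 : ℝ) • r₁ := by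
      rw [hr₁, hr₂]; module
    have hwx : w x = (2 : ℝ) • v (x + 1) - (1 / 2 : ℝ) • v (x + 2) - (3 / 2 : ℝ) • v x
        - (2 : ℝ) • r₁ + (1 / 2 : ℝ) • r₂ := by
      rw [hr₁, hr₂]; module
    constructor
    · have h5 : ‖w x‖ ≤ 2 * ‖v (x + 1)‖ + 1 / 2 * ‖v (x + 2)‖ + 3 / 2 * ‖v x‖ + 2 * ‖r₁‖
          + 1 / 2 * ‖r₂‖ := by
        rw [hwx]
        refine (norm_add_le _ _).trans (add_le_add ((norm_sub_le _ _).trans (add_le_add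
          ((norm_sub_le _ _).trans (add_le_add ((norm_sub_le _ _).trans (add_le_add ?_ ?_)) ?_))
          ?_)) ?_) <;> rw [norm_smul] <;> norm_num
      linarith
    · have h5 : ‖z x‖ ≤ ‖v (x + 2)‖ + 2 * ‖v (x + 1)‖ + ‖v x‖ + ‖r₂‖ + 2 * ‖r₁‖ := by
        rw [hzx]
        refine (norm_add_le _ _).trans (add_le_add ((norm_sub_le _ _).trans (add_le_add
          ((norm_add_le _ _).trans (add_le_add ((norm_sub_le _ _).trans (add_le_add le_rfl ?_))
          le_rfl)) le_rfl)) ?_) <;> rw [norm_smul] <;> norm_num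
      linarith
  constructor <;> rw [Metric.tendsto_nhds] <;> intro ε hε <;>
    filter_upwards [key ε hε] with x hx <;> rw [dist_zero_right]
  exacts [hx.1, hx.2]

/-! ### Partial gradients -/

section gradients

variable {W : Vec m → Vec m → ℝ}

theorem gradU_eq (hW : ContDiff ℝ 2 fun p : Vec m × Vec m => W p.1 p.2) (p : Vec m × Vec m) :
    gradU W p.1 p.2 = (InnerProductSpace.toDual ℝ (Vec m)).symm
      ((fderiv ℝ (fun p : Vec m × Vec m => W p.1 p.2) p).comp
        (ContinuousLinearMap.inl ℝ (Vec m) (Vec m))) := by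
  have h1 := (hW.differentiable (by simp) p).hasFDerivAt
  have h2 : HasFDerivAt (fun u' : Vec m => W u' p.2) _ p.1 :=
    HasFDerivAt.comp p.1 (f := fun u' : Vec m => (u', p.2)) h1 (hasFDerivAt_prodMk_left p.1 p.2)
  rw [gradU, gradient, h2.fderiv]

theorem gradV_eq (hW : ContDiff ℝ 2 fun p : Vec m × Vec m => W p.1 p.2) (p : Vec m × Vec m) :
    gradV W p.1 p.2 = (InnerProductSpace.toDual ℝ (Vec m)).symm
      ((fderiv ℝ (fun p : Vec m × Vec m => W p.1 p.2) p).comp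
        (ContinuousLinearMap.inr ℝ (Vec m) (Vec m))) := by
  have h1 := (hW.differentiable (by simp) p).hasFDerivAt
  have h2 : HasFDerivAt (fun v' : Vec m => W p.1 v') _ p.2 :=
    HasFDerivAt.comp p.2 (f := fun v' : Vec m => (p.1, v')) h1 (hasFDerivAt_prodMk_right p.1 p.2)
  rw [gradV, gradient, h2.fderiv]

theorem fderiv_apply_eq (hW : ContDiff ℝ 2 fun p : Vec m × Vec m => W p.1 p.2)
    (p : Vec m × Vec m) (a b : Vec m) :
    fderiv ℝ (fun p : Vec m × Vec m => W p.1 p.2) p (a, b)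
      = inner ℝ (gradU W p.1 p.2) a + inner ℝ (gradV W p.1 p.2) b := by
  rw [gradU_eq hW, gradV_eq hW, InnerProductSpace.toDual_symm_apply,
    InnerProductSpace.toDual_symm_apply, ContinuousLinearMap.comp_apply,
    ContinuousLinearMap.comp_apply, ContinuousLinearMap.inl_apply, ContinuousLinearMap.inr_apply,
    ← map_add]
  simp

theorem contDiff_gradU (hW : ContDiff ℝ 2 fun p : Vec m × Vec m => W p.1 p.2) :
    ContDiff ℝ 1 fun p : Vec m × Vec m => gradU W p.1 p.2 := by
  simp_rw [gradU_eq hW]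
  exact (InnerProductSpace.toDual ℝ (Vec m)).symm.contDiff.comp
    ((hW.fderiv_right (by norm_num)).clm_comp contDiff_const)

theorem contDiff_gradV (hW : ContDiff ℝ 2 fun p : Vec m × Vec m => W p.1 p.2) :
    ContDiff ℝ 1 fun p : Vec m × Vec m => gradV W p.1 p.2 := by
  simp_rw [gradV_eq hW]
  exact (InnerProductSpace.toDual ℝ (Vec m)).symm.contDiff.comp
    ((hW.fderiv_right (by norm_num)).clm_comp contDiff_const)

/-- A zero of a nonnegative function is a minimum in both variables jointly, so the gradient in the
velocity also vanishes. -/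
theorem grad_eq_zero (hW : ContDiff ℝ 2 fun p : Vec m × Vec m => W p.1 p.2)
    (hW0 : ∀ u v, 0 ≤ W u v) {a b : Vec m} (h : W a b = 0) :
    gradU W a b = 0 ∧ gradV W a b = 0 := by
  have hmin : IsLocalMin (fun p : Vec m × Vec m => W p.1 p.2) (a, b) :=
    Eventually.of_forall fun p => by simpa [h] using hW0 p.1 p.2
  have h1 := gradU_eq hW (a, b)
  have h2 := gradV_eq hW (a, b)
  rw [hmin.fderiv_eq_zero, ContinuousLinearMap.zero_comp, map_zero] at h1 h2
  exact ⟨h1, h2⟩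

theorem hasDerivAt_potential (hW : ContDiff ℝ 2 fun p : Vec m × Vec m => W p.1 p.2)
    {u v : ℝ → Vec m} {u' v' : Vec m} {x : ℝ} (hu : HasDerivAt u u' x) (hv : HasDerivAt v v' x) :
    HasDerivAt (fun x => W (u x) (v x))
      (inner ℝ (gradU W (u x) (v x)) u' + inner ℝ (gradV W (u x) (v x)) v') x := by
  have h1 := (hW.differentiable (by simp) (u x, v x)).hasFDerivAt
  have h2 := h1.comp_hasDerivAt x (hu.prodMk hv)
  rw [fderiv_apply_eq hW] at h2
  exact h2

theorem hess_apply_add_eq (hW : ContDiff ℝ 2 fun p : Vec m × Vec m => W p.1 p.2)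
    (p : Vec m × Vec m) (a b : Vec m) :
    hessUV W p.1 p.2 a + hessVV W p.1 p.2 b
      = fderiv ℝ (fun p : Vec m × Vec m => gradV W p.1 p.2) p (a, b) := by
  have h := ((contDiff_gradV hW).differentiable (by simp) p).hasFDerivAt
  have hU : HasFDerivAt (fun a : Vec m => gradV W a p.2) _ p.1 :=
    HasFDerivAt.comp p.1 (f := fun a : Vec m => (a, p.2)) h (hasFDerivAt_prodMk_left p.1 p.2)
  have hV : HasFDerivAt (fun a : Vec m => gradV W p.1 a) _ p.2 :=
    HasFDerivAt.comp p.2 (f := fun a : Vec m => (p.1, a)) h (hasFDerivAt_prodMk_right p.1 p.2)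
  rw [hessUV, hessVV, hU.fderiv, hV.fderiv, ContinuousLinearMap.comp_apply,
    ContinuousLinearMap.comp_apply, ContinuousLinearMap.inl_apply, ContinuousLinearMap.inr_apply,
    ← map_add]
  simp

theorem hasDerivAt_gradV (hW : ContDiff ℝ 2 fun p : Vec m × Vec m => W p.1 p.2)
    {u v : ℝ → Vec m} {u' v' : Vec m} {x : ℝ} (hu : HasDerivAt u u' x) (hv : HasDerivAt v v' x) :
    HasDerivAt (fun x => gradV W (u x) (v x))
      (hessUV W (u x) (v x) u' + hessVV W (u x) (v x) v') x := by
  rw [hess_apply_add_eq hW (u x, v x)]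
  exact ((contDiff_gradV hW).differentiable (by simp) (u x, v x)).hasFDerivAt.comp_hasDerivAt x
    (hu.prodMk hv)

theorem continuous_hess_apply (hW : ContDiff ℝ 2 fun p : Vec m × Vec m => W p.1 p.2)
    {u v u' v' : ℝ → Vec m} (hu : Continuous u) (hv : Continuous v) (hu' : Continuous u')
    (hv' : Continuous v') :
    Continuous fun x => hessUV W (u x) (v x) (u' x) + hessVV W (u x) (v x) (v' x) := by
  simp_rw [fun x => hess_apply_add_eq hW (u x, v x) (u' x) (v' x)]
  exact (((contDiff_gradV hW).continuous_fderiv (by simp)).comp (hu.prodMk hv)).clm_apply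
    (hu'.prodMk hv')

end gradients

/-! ### The first variation -/

namespace IsPath

variable {u v w : ℝ → Vec m} {W : Vec m → Vec m → ℝ} {φ : ℝ → ℝ}

/-- Perturbation of a path by a test function. -/
theorem add_test (h : IsPath u v w) (hφ : IsTest φ) (e : Vec m) (t : ℝ) :
    IsPath (fun x => u x + t • φ x • e) (fun x => v x + t • deriv φ x • e)
      (fun x => w x + t • deriv (deriv φ) x • e) where
  hasDerivAt x := (h.hasDerivAt x).add (((hφ.hasDerivAt x).smul_const e).const_smul t)
  velocity_eq x := by
    have hc : Continuous fun x => t • deriv (deriv φ) x • e :=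
      (hφ.deriv.deriv.continuous.smul continuous_const).const_smul t
    rw [intervalIntegral.integral_add (h.intervalIntegrable 0 x) (hc.intervalIntegrable _ _),
      intervalIntegral.integral_eq_sub_of_hasDerivAt (f := fun x => t • deriv φ x • e)
        (fun y _ => ((hφ.deriv.hasDerivAt y).smul_const e).const_smul t)
        (hc.intervalIntegrable _ _), h.velocity_eq x]
    abel
  memLp := h.memLp.add
    (((hφ.deriv.deriv.continuous.smul continuous_const).const_smul t).memLp_of_hasCompactSupport
      (hφ.deriv.deriv.compact.smul_right.smul_left))

theorem hasDerivAt_density (hW : ContDiff ℝ 2 fun p : Vec m × Vec m => W p.1 p.2) (e : Vec m)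
    (x t : ℝ) :
    HasDerivAt (fun t => density W (fun x => u x + t • φ x • e) (fun x => v x + t • deriv φ x • e)
      (fun x => w x + t • deriv (deriv φ) x • e) x)
      (inner ℝ (w x + t • deriv (deriv φ) x • e) (deriv (deriv φ) x • e)
        + (inner ℝ (gradU W (u x + t • φ x • e) (v x + t • deriv φ x • e)) (φ x • e)
        + inner ℝ (gradV W (u x + t • φ x • e) (v x + t • deriv φ x • e)) (deriv φ x • e))) t := by
  have hlin : ∀ a b : Vec m, HasDerivAt (fun t : ℝ => a + t • b) b t := fun a b => by
    simpa using! ((hasDerivAt_id t).smul_const b).const_add a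
  refine HasDerivAt.add ?_ (hasDerivAt_potential hW (hlin _ _) (hlin _ _))
  have := ((hlin (w x) (deriv (deriv φ) x • e)).norm_sq).const_mul (1 / 2)
  simpa using! this

/-- Outside the support of `φ` the density is unchanged; on a compact interval containing it the
potential is continuous and the acceleration square integrable. -/
theorem integrable_density_add_test (h : IsPath u v w)
    (hW : Continuous fun p : Vec m × Vec m => W p.1 p.2)
    (hi : Integrable (density W u v w)) (hφ : IsTest φ) (e : Vec m) (t : ℝ) :
    Integrable (density W (fun x => u x + t • φ x • e) (fun x => v x + t • deriv φ x • e)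
      (fun x => w x + t • deriv (deriv φ) x • e)) := by
  obtain ⟨r, hr, hs⟩ := hφ.exists_tsupport_subset
  rw [← integrableOn_univ, ← union_compl_self (Icc (-r) r)]
  refine IntegrableOn.union ?_ ?_
  · exact (h.add_test hφ e t).integrable_sq.integrableOn.add
      (((h.add_test hφ e t).continuous_potential hW).continuousOn.integrableOn_compact isCompact_Icc)
  · refine hi.integrableOn.congr_fun (fun x hx => ?_) measurableSet_Icc.compl
    have hx' : x ∉ Ioo (-r) r := fun h' => hx (Ioo_subset_Icc_self h')
    simp only [density, eq_zero_of_tsupport_subset hs hx',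
      eq_zero_of_tsupport_subset ((tsupport_deriv_subset).trans hs) hx',
      eq_zero_of_tsupport_subset ((tsupport_deriv_subset).trans ((tsupport_deriv_subset).trans hs))
        hx', zero_smul, smul_zero, add_zero]

/-- The Euler–Lagrange equation in weak form. -/
theorem weak_euler_lagrange (h : IsPath u v w)
    (hW : ContDiff ℝ 2 fun p : Vec m × Vec m => W p.1 p.2)
    (hi : Integrable (density W u v w)) (hφ : IsTest φ)
    (hmin : ∀ (e : Vec m) (t : ℝ), ∫ x, density W u v w x ≤ ∫ x, density W (fun x => u x + t • φ x • e)
      (fun x => v x + t • deriv φ x • e) (fun x => w x + t • deriv (deriv φ) x • e) x) :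
    ∫ x, (deriv (deriv φ) x • w x + (φ x • gradU W (u x) (v x)
      + deriv φ x • gradV W (u x) (v x))) = 0 := by
  have hgU : Continuous fun x => gradU W (u x) (v x) :=
    (contDiff_gradU hW).continuous.comp (h.continuous.prodMk h.continuous_velocity)
  have hgV : Continuous fun x => gradV W (u x) (v x) :=
    (contDiff_gradV hW).continuous.comp (h.continuous.prodMk h.continuous_velocity)
  refine ext_inner_left ℝ fun e => ?_
  rw [inner_zero_right, ← integral_inner ((hφ.deriv.deriv.integrable_smul h.locallyIntegrable).fun_add
    ((hφ.integrable_smul hgU.locallyIntegrable).fun_add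
      (hφ.deriv.integrable_smul hgV.locallyIntegrable)))]
  obtain ⟨r, hr, hs⟩ := hφ.exists_tsupport_subset
  set F : ℝ → ℝ → ℝ := fun t => density W (fun x => u x + t • φ x • e)
    (fun x => v x + t • deriv φ x • e) (fun x => w x + t • deriv (deriv φ) x • e) with hF
  set F' : ℝ → ℝ → ℝ := fun t x =>
    inner ℝ (w x + t • deriv (deriv φ) x • e) (deriv (deriv φ) x • e)
      + (inner ℝ (gradU W (u x + t • φ x • e) (v x + t • deriv φ x • e)) (φ x • e)
      + inner ℝ (gradV W (u x + t • φ x • e) (v x + t • deriv φ x • e)) (deriv φ x • e)) with hF'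
  have hcφ := hφ.continuous
  have hcφ' := hφ.deriv.continuous
  have hcφ'' := hφ.deriv.deriv.continuous
  have hcu := h.continuous
  have hcv := h.continuous_velocity
  have hpair : Continuous fun p : ℝ × ℝ =>
      (u p.2 + p.1 • φ p.2 • e, v p.2 + p.1 • deriv φ p.2 • e) := by fun_prop
  have hcU : Continuous fun p : ℝ × ℝ =>
      gradU W (u p.2 + p.1 • φ p.2 • e) (v p.2 + p.1 • deriv φ p.2 • e) :=
    (contDiff_gradU hW).continuous.comp hpair
  have hcV : Continuous fun p : ℝ × ℝ =>
      gradV W (u p.2 + p.1 • φ p.2 • e) (v p.2 + p.1 • deriv φ p.2 • e) :=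
    (contDiff_gradV hW).continuous.comp hpair
  -- This is the derivative of the density without its term in `w`, which is only square integrable.
  -- The continuous part is bounded by `K` for `|t| ≤ 1` on the support, and the term in `w` is
  -- dominated separately.
  have hcont : Continuous fun p : ℝ × ℝ =>
      inner ℝ (p.1 • deriv (deriv φ) p.2 • e) (deriv (deriv φ) p.2 • e)
      + (inner ℝ (gradU W (u p.2 + p.1 • φ p.2 • e) (v p.2 + p.1 • deriv φ p.2 • e)) (φ p.2 • e)
      + inner ℝ (gradV W (u p.2 + p.1 • φ p.2 • e) (v p.2 + p.1 • deriv φ p.2 • e))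
        (deriv φ p.2 • e)) := by fun_prop
  obtain ⟨K, hK⟩ := (isCompact_Icc (a := (-1 : ℝ)) (b := 1)).prod
    (isCompact_Icc (a := -r) (b := r)) |>.exists_bound_of_continuousOn hcont.continuousOn
  have hIw : Integrable fun x => deriv (deriv φ) x • w x :=
    hφ.deriv.deriv.integrable_smul h.locallyIntegrable
  have hdiff : ∀ x t, HasDerivAt (fun t => F t x) (F' t x) t := fun x t =>
    hasDerivAt_density hW e x t
  have hFi : ∀ t, Integrable (F t) := fun t =>
    h.integrable_density_add_test hW.continuous hi hφ e t
  have hzero : ∀ t, ∀ x ∉ Icc (-r) r, F' t x = 0 := fun t x hx => by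
    have hx' : x ∉ Ioo (-r) r := fun h' => hx (Ioo_subset_Icc_self h')
    simp only [hF', eq_zero_of_tsupport_subset hs hx',
      eq_zero_of_tsupport_subset ((tsupport_deriv_subset).trans hs) hx',
      eq_zero_of_tsupport_subset ((tsupport_deriv_subset).trans ((tsupport_deriv_subset).trans hs))
        hx', zero_smul, inner_zero_right, add_zero]
  have hF'eq : ∀ t x, F' t x = inner ℝ e (deriv (deriv φ) x • w x)
      + (inner ℝ (t • deriv (deriv φ) x • e) (deriv (deriv φ) x • e)
      + (inner ℝ (gradU W (u x + t • φ x • e) (v x + t • deriv φ x • e)) (φ x • e)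
      + inner ℝ (gradV W (u x + t • φ x • e) (v x + t • deriv φ x • e)) (deriv φ x • e))) :=
    fun t x => by
      simp only [hF', inner_add_left, real_inner_smul_right, real_inner_comm e (w x)]
      ring
  have hder := hasDerivAt_integral_of_dominated_loc_of_deriv_le (μ := volume) (F := F) (F' := F')
    (x₀ := (0 : ℝ)) (s := Icc (-1) 1)
    (bound := fun x => ‖e‖ * ‖deriv (deriv φ) x • w x‖ + (Icc (-r) r).indicator (fun _ => K) x)
    (Icc_mem_nhds (by norm_num) (by norm_num))
    (Eventually.of_forall fun t => (hFi t).1) (hFi 0)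
    (by
      rw [funext (hF'eq 0)]
      refine (hIw.1.const_inner).add ?_
      exact (hcont.comp (Continuous.prodMk_right (0 : ℝ))).aestronglyMeasurable)
    (Eventually.of_forall fun x t ht => by
      by_cases hx : x ∈ Icc (-r) r
      · rw [indicator_of_mem hx, hF'eq]
        exact (norm_add_le _ _).trans (add_le_add (norm_inner_le_norm _ _) (hK (t, x) ⟨ht, hx⟩))
      · rw [indicator_of_notMem hx, hzero t x hx, norm_zero]
        positivity)
    ((hIw.norm.const_mul _).add ((integrable_indicator_iff measurableSet_Icc).2
      (integrableOn_const (by simp))))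
    (Eventually.of_forall fun x t _ => hdiff x t)
  have hF0 : F 0 = density W u v w := by
    simp only [hF, zero_smul, add_zero]
  have hlm : IsLocalMin (fun t => ∫ x, F t x) 0 := Eventually.of_forall fun t => by
    simp only [hF0]
    exact hmin e t
  have := hlm.hasDerivAt_eq_zero hder.2
  rw [← this]
  refine integral_congr_ae (Eventually.of_forall fun x => ?_)
  simp only [hF', zero_smul, add_zero, inner_add_right, real_inner_smul_right,
    real_inner_comm e]
  ring

/-- Regularity of weak solutions of the Euler–Lagrange equation. -/
theorem exists_acc_eq (h : IsPath u v w)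
    (hW : ContDiff ℝ 2 fun p : Vec m × Vec m => W p.1 p.2)
    (hEL : ∀ φ, IsTest φ → ∫ x, (deriv (deriv φ) x • w x + (φ x • gradU W (u x) (v x)
      + deriv φ x • gradV W (u x) (v x))) = 0) :
    ∃ (b : Vec m) (w' z : ℝ → Vec m), w =ᵐ[volume] w' ∧ (∀ x, HasDerivAt v (w' x) x) ∧
      (∀ x, HasDerivAt w' (z x) x) ∧
      ∀ x, z x = b + gradV W (u x) (v x) - ∫ t in (0 : ℝ)..x, gradU W (u t) (v t) := by
  have hgU : Continuous fun x => gradU W (u x) (v x) :=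
    (contDiff_gradU hW).continuous.comp (h.continuous.prodMk h.continuous_velocity)
  have hgV : Continuous fun x => gradV W (u x) (v x) :=
    (contDiff_gradV hW).continuous.comp (h.continuous.prodMk h.continuous_velocity)
  set P : ℝ → Vec m := fun x => ∫ t in (0 : ℝ)..x, gradU W (u t) (v t) with hP
  have hPc : Continuous P := continuous_primitive hgU.locallyIntegrable
  set Q : ℝ → Vec m := fun x => gradV W (u x) (v x) - P x with hQ
  have hQc : Continuous Q := hgV.sub hPc
  set R : ℝ → Vec m := fun x => ∫ t in (0 : ℝ)..x, Q t with hR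
  have hRc : Continuous R := continuous_primitive hQc.locallyIntegrable
  have hR' : ∀ x, HasDerivAt R (Q x) x := fun x => by
    simpa using hasDerivAt_add_primitive hQc 0 x
  -- Moving all derivatives onto `φ` turns the weak equation into `∫ φ'' (w - R) = 0`, where `R' =
  -- Q` and `Q` is `gradV` minus a primitive of `gradU`.
  obtain ⟨a, b, hab⟩ := ae_eq_affine_of_integral_deriv_deriv_smul_eq_zero
    (f := fun x => w x - R x) (h.locallyIntegrable.sub hRc.locallyIntegrable) fun φ hφ => by
      have i1 := hφ.deriv.deriv.integrable_smul h.locallyIntegrable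
      have i2 := hφ.integrable_smul hgU.locallyIntegrable
      have i3 := hφ.deriv.integrable_smul hgV.locallyIntegrable
      have i4 := hφ.deriv.integrable_smul hPc.locallyIntegrable
      have e1 := hEL φ hφ
      have e2 := integral_deriv_smul_primitive hgU.locallyIntegrable hφ
      have e3 := integral_deriv_smul_primitive hQc.locallyIntegrable hφ.deriv
      simp only [hQ, smul_sub] at e3
      rw [integral_sub i3 i4] at e3
      rw [integral_add i1 (i2.fun_add i3), integral_add i2 i3] at e1
      simp only [smul_sub]
      rw [integral_sub i1 (hφ.deriv.deriv.integrable_smul hRc.locallyIntegrable)]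
      change (∫ x, deriv (deriv φ) x • R x) = _ at e3
      change (∫ x, deriv φ x • P x) = _ at e2
      rw [e3, e2, ← e1]
      abel
  set w' : ℝ → Vec m := fun x => a + x • b + R x with hw'
  have hww' : w =ᵐ[volume] w' := by
    filter_upwards [hab] with x hx
    simp only [hw', ← hx, sub_add_cancel]
  have hw'd : ∀ x, HasDerivAt w' (b + Q x) x := fun x => by
    have h1 : HasDerivAt (fun x : ℝ => a + x • b) b x := by
      simpa using! ((hasDerivAt_id x).smul_const b).const_add a
    exact h1.add (hR' x)
  have hw'c : Continuous w' := continuous_iff_continuousAt.2 fun x => (hw'd x).continuousAt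
  refine ⟨b, w', fun x => b + Q x, hww', fun x => ?_, hw'd, fun x => ?_⟩
  · have hv : v = fun x => v 0 + ∫ t in (0 : ℝ)..x, w' t := funext fun y => by
      rw [h.velocity_eq y]
      congr 1
      exact intervalIntegral.integral_congr_ae (hww'.mono fun t ht _ => ht)
    rw [hv]
    exact hasDerivAt_add_primitive hw'c _ x
  · simp only [hQ, hP]
    abel

end IsPath

/-! ### Existence of a minimizer -/

/-- The set where the bound fails is open and null, hence empty. -/
theorem le_of_ae_of_continuous {f : ℝ → ℝ} (hf : Continuous f) {U : Set ℝ} (hU : IsOpen U) {q : ℝ}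
    (h : ∀ᵐ x : ℝ, x ∈ U → f x ≤ q) {x : ℝ} (hx : x ∈ U) : f x ≤ q := by
  by_contra! hlt
  have ho : IsOpen (U ∩ {y | q < f y}) := hU.inter (isOpen_lt continuous_const hf)
  have hz : volume (U ∩ {y | q < f y}) = 0 := by
    refine measure_mono_null (fun y hy => ?_) (ae_iff.1 h)
    exact fun h' => absurd (h' hy.1) (not_le.2 hy.2)
  have := ho.eq_empty_of_measure_zero hz
  exact notMem_empty x (this ▸ ⟨hx, hlt⟩)

theorem IsPath.mem_connectingClass {u v w : ℝ → Vec m} (h : IsPath u v w) {S T : Set (Vec m)}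
    {q a b : ℝ} (ha : ∀ x ≤ a, Metric.infDist (u x) S ≤ q)
    (hb : ∀ x, b ≤ x → Metric.infDist (u x) T ≤ q) : u ∈ connectingClass S T q :=
  -- Lowering `a` secures the strict inequality that the class requires.
  ⟨h.memW22loc, min a (b - 1), b, by linarith [min_le_right a (b - 1)],
    Eventually.of_forall fun x hx => ha x (hx.trans (min_le_left _ _)), Eventually.of_forall hb⟩

/-- Maps of finite energy in the connecting class are represented by paths satisfying the
bounds at every point. -/
theorem exists_isPath_of_mem_connectingClass {W : Vec m → Vec m → ℝ} (hW0 : ∀ u v, 0 ≤ W u v)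
    {S T : Set (Vec m)} {q : ℝ} {u : ℝ → Vec m} (hu : u ∈ connectingClass S T q)
    (hE : energy W u < ⊤) :
    ∃ p v w, IsPath p v w ∧ energy W u = action W p v w ∧ ∃ a b : ℝ,
      (∀ x ≤ a, Metric.infDist (p x) S ≤ q) ∧ ∀ x, b ≤ x → Metric.infDist (p x) T ≤ q := by
  obtain ⟨hu2, a, b, -, ha, hb⟩ := hu
  obtain ⟨p, v, w, hp, hup, hEp⟩ := exists_isPath_of_energy_lt_top hW0 hu2 hE
  -- Moving inwards by `1` places the closed half-lines inside the open ones, where an almost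
  -- everywhere bound becomes pointwise.
  refine ⟨p, v, w, hp, hEp, a - 1, b + 1, fun x hx => ?_, fun x hx => ?_⟩
  · refine le_of_ae_of_continuous ((Metric.continuous_infDist_pt S).comp hp.continuous)
      (isOpen_Iio (a := a)) ?_ (show x < a by linarith)
    filter_upwards [ha, hup] with y hy hyp hya
    simpa [← hyp] using hy (le_of_lt hya)
  · refine le_of_ae_of_continuous ((Metric.continuous_infDist_pt T).comp hp.continuous)
      (isOpen_Ioi (a := b)) ?_ (show b < x by linarith)
    filter_upwards [hb, hup] with y hy hyp hya
    simpa [← hyp] using hy (le_of_lt hya)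

theorem tsupport_deriv_smoothTransition : tsupport (deriv Real.smoothTransition) ⊆ Icc 0 1 := by
  refine closure_minimal (fun x hx => ?_) isClosed_Icc
  by_contra h
  refine hx ?_
  rcases lt_or_ge x 0 with h0 | h0
  · have : Real.smoothTransition =ᶠ[𝓝 x] fun _ => 0 := by
      filter_upwards [Iio_mem_nhds h0] with y hy
      exact Real.smoothTransition.zero_of_nonpos (le_of_lt hy)
    rw [this.deriv_eq, deriv_const]
  · have h1 : 1 < x := by
      by_contra h'
      exact h ⟨h0, not_lt.1 h'⟩
    have : Real.smoothTransition =ᶠ[𝓝 x] fun _ => 1 := by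
      filter_upwards [Ioi_mem_nhds h1] with y hy
      exact Real.smoothTransition.one_of_one_le (le_of_lt hy)
    rw [this.deriv_eq, deriv_const]

theorem isTest_deriv_smoothTransition : IsTest (deriv Real.smoothTransition) :=
  ⟨((contDiff_infty_iff_deriv (𝕜 := ℝ)).1 Real.smoothTransition.contDiff).2,
    isCompact_Icc.of_isClosed_subset (isClosed_tsupport _) tsupport_deriv_smoothTransition⟩

/-- Two zeros of `W(·, 0)` are joined by a path of finite energy. -/
theorem exists_mem_connectingClass_energy_lt_top {W : Vec m → Vec m → ℝ}
    (hW : Continuous fun p : Vec m × Vec m => W p.1 p.2) (hW0 : ∀ u v, 0 ≤ W u v)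
    {S T : Set (Vec m)} {q : ℝ} (hq : 0 ≤ q) {a b : Vec m} (ha : a ∈ S) (hb : b ∈ T)
    (hWa : W a 0 = 0) (hWb : W b 0 = 0) :
    ∃ u ∈ connectingClass S T q, energy W u < ⊤ := by
  set χ := Real.smoothTransition with hχ
  have h1 : IsTest (deriv χ) := isTest_deriv_smoothTransition
  have hs : tsupport (deriv χ) ⊆ Icc 0 1 := tsupport_deriv_smoothTransition
  have hχd : ∀ x, HasDerivAt χ (deriv χ x) x := fun x =>
    ((Real.smoothTransition.contDiff (n := 1)).differentiable (by simp) x).hasDerivAt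
  have hwc : Continuous fun x => deriv (deriv χ) x • (b - a) :=
    h1.deriv.continuous.smul continuous_const
  have hp : IsPath (fun x => a + χ x • (b - a)) (fun x => deriv χ x • (b - a))
      (fun x => deriv (deriv χ) x • (b - a)) := by
    refine ⟨fun x => ((hχd x).smul_const (b - a)).const_add a, fun x => ?_,
      hwc.memLp_of_hasCompactSupport h1.deriv.compact.smul_right⟩
    · rw [intervalIntegral.integral_eq_sub_of_hasDerivAt
        (fun y _ => (h1.hasDerivAt y).smul_const (b - a)) (hwc.intervalIntegrable _ _)]
      abel
  refine ⟨_, hp.mem_connectingClass (a := 0) (b := 1) (fun x hx => ?_) (fun x hx => ?_), ?_⟩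
  · simp [hχ, Real.smoothTransition.zero_of_nonpos hx, Metric.infDist_zero_of_mem ha, hq]
  · simp [hχ, Real.smoothTransition.one_of_one_le hx, Metric.infDist_zero_of_mem hb, hq]
  · rw [hp.energy_eq]
    have hi : Integrable (density W (fun x => a + χ x • (b - a)) (fun x => deriv χ x • (b - a))
        (fun x => deriv (deriv χ) x • (b - a))) := by
      refine Continuous.integrable_of_hasCompactSupport ?_
        (HasCompactSupport.intro (isCompact_Icc (a := (0 : ℝ)) (b := 1)) fun x hx => ?_)
      · exact ((hwc.norm.pow 2).const_mul _).add (hp.continuous_potential hW)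
      · have e1 : deriv χ x = 0 := image_eq_zero_of_notMem_tsupport fun h => hx (hs h)
        have e2 : deriv (deriv χ) x = 0 :=
          image_eq_zero_of_notMem_tsupport fun h => hx (hs (tsupport_deriv_subset h))
        simp only [density, e1, e2, zero_smul, norm_zero]
        rcases lt_or_ge x 0 with h | h
        · simp [hχ, Real.smoothTransition.zero_of_nonpos h.le, hWa]
        · have : 1 ≤ x := by
            by_contra h'
            exact hx ⟨h, (not_le.1 h').le⟩
          simp [hχ, Real.smoothTransition.one_of_one_le this, hWb]
    rw [action, ← ofReal_integral_eq_lintegral_ofReal hi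
      (Eventually.of_forall fun x => IsPath.density_nonneg hW0 x)]
    exact ENNReal.ofReal_lt_top

/-- The nearest point of the compact union cannot lie in `T`, since that would put `p` closer to `T`
than `q`. -/
theorem infDist_left_le_of_lt {X : Type*} [MetricSpace X] {S T : Set X} (hS : IsCompact S)
    (hT : IsCompact T) (hne : (S ∪ T).Nonempty) {p : X} {q : ℝ} (h1 : q ≤ Metric.infDist p T)
    (h2 : Metric.infDist p (S ∪ T) < q) : Metric.infDist p S ≤ Metric.infDist p (S ∪ T) := by
  obtain ⟨a, ha, hd⟩ := (hS.union hT).exists_infDist_eq_dist hne p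
  rcases ha with ha | ha
  · rw [hd]; exact Metric.infDist_le_dist_of_mem ha
  · have := Metric.infDist_le_dist_of_mem (x := p) ha
    linarith

theorem tendsto_infDist_left {X ι : Type*} [MetricSpace X] {S T : Set X} (hS : IsCompact S)
    (hT : IsCompact T) (hne : (S ∪ T).Nonempty) {q : ℝ} (hq : 0 < q) {l : Filter ι} {u : ι → X}
    (h1 : ∀ᶠ x in l, q ≤ Metric.infDist (u x) T)
    (h2 : Tendsto (fun x => Metric.infDist (u x) (S ∪ T)) l (𝓝 0)) :
    Tendsto (fun x => Metric.infDist (u x) S) l (𝓝 0) := by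
  refine squeeze_zero' (Eventually.of_forall fun _ => Metric.infDist_nonneg) ?_ h2
  filter_upwards [h1, h2.eventually_lt_const hq] with x hx hx'
  exact infDist_left_le_of_lt hS hT hne hx hx'

/-- A minimizing sequence, translated so that a transition out of `Ω` stays near the origin, keeps
both ends of the connection in the limit. The bounds are recorded for the asymptotic analysis. -/
theorem exists_minimal_path {W : Vec m → Vec m → ℝ} {Aminus Aplus Ω : Set (Vec m)} {q : ℝ}
    (hW : Continuous fun p : Vec m × Vec m => W p.1 p.2) (hW0 : ∀ u v, 0 ≤ W u v)
    (h1 : HypH1 W Aminus Aplus) (h2 : HypH2 W Aminus Aplus Ω) (h3 : HypH3 W)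
    (hq : AdmissibleRadius Aminus Aplus Ω q) :
    ∃ (u v w : ℝ → Vec m) (C B M : ℝ), 0 < B ∧ 0 < M ∧ IsBoundedPath W C B M u v w ∧
      u ∈ connectingClass Aminus Aplus q ∧
      (∀ u' ∈ connectingClass Aminus Aplus q, energy W u ≤ energy W u') ∧ energy W u < ⊤ ∧
      Tendsto (fun x => Metric.infDist (u x) Aminus) atBot (𝓝 0) ∧
      Tendsto (fun x => Metric.infDist (u x) Aplus) atTop (𝓝 0) := by
  obtain ⟨am, ham⟩ := h1.nonempty_minus
  obtain ⟨ap, hap⟩ := h1.nonempty_plus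
  have hWam : W am 0 = 0 := by
    have : am ∈ {u | W u 0 = 0} := h1.union_eq ▸ Or.inl ham
    exact this
  have hWap : W ap 0 = 0 := by
    have : ap ∈ {u | W u 0 = 0} := h1.union_eq ▸ Or.inr hap
    exact this
  obtain ⟨u₀, hu₀, hu₀E⟩ := exists_mem_connectingClass_energy_lt_top hW hW0 hq.pos.le ham hap
    hWam hWap
  set e : ℝ≥0∞ := ⨅ u ∈ connectingClass Aminus Aplus q, energy W u with he
  have hetop : e < ⊤ := (iInf₂_le u₀ hu₀).trans_lt hu₀E
  set E : ℝ := e.toReal with hEdef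
  have hEe : ENNReal.ofReal E = e := ENNReal.ofReal_toReal hetop.ne
  have hE0 : 0 ≤ E := ENNReal.toReal_nonneg
  have hseq : ∀ n : ℕ, ∃ p v w, IsPath p v w ∧
      action W p v w ≤ ENNReal.ofReal (E + 1 / (n + 1)) ∧ ∃ a b : ℝ,
      (∀ x ≤ a, Metric.infDist (p x) Aminus ≤ q) ∧
      ∀ x, b ≤ x → Metric.infDist (p x) Aplus ≤ q := fun n => by
    have hpos : (0 : ℝ) < 1 / (n + 1) := Nat.one_div_pos_of_nat
    have hlt : e < ENNReal.ofReal (E + 1 / (n + 1)) := by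
      rw [← hEe]
      exact (ENNReal.ofReal_lt_ofReal_iff (by linarith)).2 (by linarith)
    obtain ⟨u, hu, hlt'⟩ := by simpa only [he, iInf_lt_iff, exists_prop] using hlt
    obtain ⟨p, v, w, hp, hpE, hab⟩ := exists_isPath_of_mem_connectingClass hW0 hu
      (hlt'.trans ENNReal.ofReal_lt_top)
    exact ⟨p, v, w, hp, hpE ▸ hlt'.le, hab⟩
  choose p v w hp hpE a b ha hb using hseq
  obtain ⟨B, M, hB, hM, hbound⟩ := exists_isBoundedPath hW0 h3 (E + 1)
  have hint : ∀ n, Integrable (density W (p n) (v n) (w n)) := fun n =>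
    (hp n).integrable_density hW hW0 ((hpE n).trans_lt ENNReal.ofReal_lt_top)
  have hle : ∀ n : ℕ, ∫ x, density W (p n) (v n) (w n) x ≤ E + 1 / (n + 1) := fun n =>
    (hp n).integral_density_le hW hW0 (add_nonneg hE0 Nat.one_div_pos_of_nat.le) (hpE n)
  have hone : ∀ n : ℕ, (1 : ℝ) / (n + 1) ≤ 1 := fun n => by
    rw [div_le_one (by positivity)]
    linarith [Nat.cast_nonneg (α := ℝ) n]
  have hbp : ∀ n, IsBoundedPath W (E + 1) B M (p n) (v n) (w n) := fun n =>
    hbound _ _ _ (hp n) (hint n) ((hle n).trans (by linarith [hone n]))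
  have hΩa : ∀ n, ∀ x ≤ a n, p n x ∈ Ω := fun n x hx => hq.subset (ha n x hx)
  have hΩb : ∀ n, ∀ x, b n ≤ x → p n x ∉ Ω := fun n x hx h =>
    Set.disjoint_left.1 hq.disjoint (hb n x hx) (subset_closure h)
  obtain ⟨η, N, hcard⟩ := exists_card_crossing_le (C := E + 1) hW hW0 h2.pos (B := B) hM
  obtain ⟨L, hL, hcl⟩ := exists_cluster_centres (Z := fun n => {x | p n x ∈ frontier Ω})
    (fun n => by
      by_contra hempty
      rw [not_nonempty_iff_eq_empty] at hempty
      refine hΩb n (b n) le_rfl ((mem_iff_of_forall_notMem_frontier h2.isOpen (hp n).continuous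
        fun t _ ht => ?_).1 (hΩa n (a n) le_rfl))
      exact notMem_empty t (hempty ▸ ht))
    (fun n F hF hsep => hcard _ _ _ (hbp n) F hF hsep)
  have hsel : ∀ k : ℕ, ∃ n, k ≤ n ∧ ∃ y,
      (∀ x ∈ Ioo (y - (k + L + 1)) (y - L), p n x ∈ Ω) ∧
      ∀ x ∈ Ioo (y + L) (y + (k + L + 1)), p n x ∉ Ω := fun k => by
    -- The separation is chosen so that `T - L = k + L + 1`; both stays then have length `k + 1` and
    -- exhaust the half-lines as `k` grows.
    obtain ⟨n, hkn, F, hFne, hsep, hcov⟩ := (frequently_atTop.1 (hcl (k + 2 * L + 1))) k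
    obtain ⟨y, hy1, hy2⟩ := exists_transition h2.isOpen (hp n).continuous (hΩa n) (hΩb n) hL
      (by linarith [Nat.cast_nonneg (α := ℝ) k]) hFne hsep hcov
    rw [show (k : ℝ) + 2 * L + 1 - L = k + L + 1 by ring] at hy1 hy2
    exact ⟨n, hkn, y, hy1, hy2⟩
  choose φ hφ y hyin hyout using hsel
  have hlim0 : Tendsto (fun n : ℕ => (1 : ℝ) / (n + 1)) atTop (𝓝 0) :=
    tendsto_one_div_add_atTop_nhds_zero_nat
  obtain ⟨ψ, u, v', w', hψ, hpath, hulim, haction⟩ := exists_limit_path hW hW0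
    (fun k => (hbp (φ k)).comp_add (y k)) (E := E) fun ε hε => by
      filter_upwards [hlim0.eventually_le_const hε] with k hk
      refine (integral_add_right_eq_self (density W (p (φ k)) (v (φ k)) (w (φ k))) (y k)).trans_le
        ((hle (φ k)).trans ?_)
      have : (1 : ℝ) / (φ k + 1) ≤ 1 / (k + 1) := by
        have := hφ k
        gcongr
      linarith
  have hk : ∀ x : ℝ, ∀ᶠ k : ℕ in atTop, |x| < ψ k + 1 := fun x => by
    obtain ⟨K, hK⟩ := exists_nat_gt |x|
    filter_upwards [eventually_ge_atTop K] with k hk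
    have h4 : (K : ℝ) ≤ ψ k := by exact_mod_cast hk.trans (hψ.id_le k)
    linarith
  -- Pointwise limits keep only closed conditions: the closure of `Ω` on the left, its complement on
  -- the right. The radius `q` separates each from the wrong part of the zero set.
  have hin : ∀ x < -L, u x ∈ closure Ω := fun x hx =>
    mem_closure_of_tendsto (hulim x) (by
      filter_upwards [hk x] with k hk
      refine hyin (ψ k) (x + y (ψ k)) ⟨?_, ?_⟩ <;> linarith [neg_abs_le x])
  have hout : ∀ x, L < x → u x ∉ Ω := fun x hx =>
    h2.isOpen.isClosed_compl.mem_of_tendsto (hulim x) (by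
      filter_upwards [hk x] with k hk
      refine hyout (ψ k) (x + y (ψ k)) ⟨?_, ?_⟩ <;> linarith [le_abs_self x])
  have huint : Integrable (density W u v' w') :=
    hpath.integrable_density hW hW0 (haction.trans_lt ENNReal.ofReal_lt_top)
  have hubp : IsBoundedPath W (E + 1) B M u v' w' := hbound _ _ _ hpath huint
    ((hpath.integral_density_le hW hW0 hE0 haction).trans (by linarith))
  have hdist := hubp.tendsto_infDist hW hW0 hB hM h1.union_eq
  rw [cocompact_eq_atBot_atTop, tendsto_sup] at hdist
  have hne : (Aminus ∪ Aplus).Nonempty := ⟨am, Or.inl ham⟩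
  have hminus : Tendsto (fun x => Metric.infDist (u x) Aminus) atBot (𝓝 0) := by
    refine tendsto_infDist_left h1.compact_minus h1.compact_plus hne hq.pos ?_ hdist.1
    filter_upwards [eventually_lt_atBot (-L)] with x hx
    by_contra! hlt
    exact Set.disjoint_left.1 hq.disjoint hlt.le (hin x hx)
  have hplus : Tendsto (fun x => Metric.infDist (u x) Aplus) atTop (𝓝 0) := by
    rw [union_comm] at hne hdist
    refine tendsto_infDist_left h1.compact_plus h1.compact_minus hne hq.pos ?_ hdist.2
    filter_upwards [eventually_gt_atTop L] with x hx
    by_contra! hlt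
    exact hout x hx (hq.subset hlt.le)
  obtain ⟨α, hα⟩ := eventually_atBot.1 (hminus.eventually_le_const hq.pos)
  obtain ⟨β, hβ⟩ := eventually_atTop.1 (hplus.eventually_le_const hq.pos)
  refine ⟨u, v', w', E + 1, B, M, hB, hM, hubp, hpath.mem_connectingClass hα hβ, fun u' hu' => ?_,
    ?_, hminus, hplus⟩
  · rw [hpath.energy_eq]
    exact haction.trans (hEe.trans_le (iInf₂_le u' hu'))
  · rw [hpath.energy_eq]
    exact haction.trans_lt ENNReal.ofReal_lt_top

/-! ### Regularity and behaviour at infinity of minimizers -/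

theorem contDiff_four_of_hasDerivAt {u v w z y : ℝ → Vec m} (hu : ∀ x, HasDerivAt u (v x) x)
    (hv : ∀ x, HasDerivAt v (w x) x) (hw : ∀ x, HasDerivAt w (z x) x)
    (hz : ∀ x, HasDerivAt z (y x) x) (hy : Continuous y) :
    ContDiff ℝ 4 u ∧ iteratedDeriv 1 u = v ∧ iteratedDeriv 2 u = w ∧ iteratedDeriv 3 u = z ∧
      iteratedDeriv 4 u = y := by
  have e1 : deriv u = v := funext fun x => (hu x).deriv
  have e2 : deriv v = w := funext fun x => (hv x).deriv
  have e3 : deriv w = z := funext fun x => (hw x).deriv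
  have e4 : deriv z = y := funext fun x => (hz x).deriv
  have step : ∀ (n : ℕ) (f g : ℝ → Vec m), (∀ x, HasDerivAt f (g x) x) → ContDiff ℝ n g →
      ContDiff ℝ (n + 1 : ℕ) f := fun n f g hf hg => by
    have : deriv f = g := funext fun x => (hf x).deriv
    rw [Nat.cast_add, Nat.cast_one, contDiff_succ_iff_deriv]
    exact ⟨fun x => (hf x).differentiableAt, by simp, this ▸ hg⟩
  have c0 : ContDiff ℝ (0 : ℕ) y := contDiff_zero.2 hy
  have c4 := step _ _ _ hu (step _ _ _ hv (step _ _ _ hw (step _ _ _ hz c0)))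
  have i2 : iteratedDeriv 2 u = w := by
    rw [iteratedDeriv_succ, iteratedDeriv_one, e1, e2]
  have i3 : iteratedDeriv 3 u = z := by rw [iteratedDeriv_succ, i2, e3]
  refine ⟨by exact_mod_cast c4, by rw [iteratedDeriv_one, e1], i2, i3, ?_⟩
  rw [iteratedDeriv_succ, i3, e4]

/-- Minimizing paths satisfy the weak Euler–Lagrange equation. -/
theorem IsPath.weak_euler_lagrange_of_minimal {W : Vec m → Vec m → ℝ} {S T : Set (Vec m)} {q : ℝ}
    (hW : ContDiff ℝ 2 fun p : Vec m × Vec m => W p.1 p.2) (hW0 : ∀ u v, 0 ≤ W u v)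
    {u v w : ℝ → Vec m} (h : IsPath u v w) (hi : Integrable (density W u v w))
    (hS : ∀ᶠ x in atBot, Metric.infDist (u x) S ≤ q)
    (hT : ∀ᶠ x in atTop, Metric.infDist (u x) T ≤ q)
    (hmin : ∀ u' ∈ connectingClass S T q, energy W u ≤ energy W u') {φ : ℝ → ℝ} (hφ : IsTest φ) :
    ∫ x, (deriv (deriv φ) x • w x + (φ x • gradU W (u x) (v x)
      + deriv φ x • gradV W (u x) (v x))) = 0 := by
  refine h.weak_euler_lagrange hW hi hφ fun e t => ?_
  obtain ⟨r, hr, hs⟩ := hφ.exists_tsupport_subset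
  obtain ⟨a, ha⟩ := eventually_atBot.1 hS
  obtain ⟨b, hb⟩ := eventually_atTop.1 hT
  have hp := h.add_test hφ e t
  have hmem : (fun x => u x + t • φ x • e) ∈ connectingClass S T q := by
    refine hp.mem_connectingClass (a := min a (-r)) (b := max b r) (fun x hx => ?_) fun x hx => ?_
    · have h0 : φ x = 0 := eq_zero_of_tsupport_subset hs fun h' => by
        linarith [h'.1, min_le_right a (-r)]
      simpa [h0] using ha x (hx.trans (min_le_left _ _))
    · have h0 : φ x = 0 := eq_zero_of_tsupport_subset hs fun h' => by
        linarith [h'.2, le_max_right b r]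
      simpa [h0] using hb x ((le_max_left _ _).trans hx)
  have h1 := hmin _ hmem
  have hi' := h.integrable_density_add_test hW.continuous hi hφ e t
  rw [h.energy_eq, hp.energy_eq, action, action, ← ofReal_integral_eq_lintegral_ofReal hi
      (Eventually.of_forall fun x => IsPath.density_nonneg hW0 x),
    ← ofReal_integral_eq_lintegral_ofReal hi'
      (Eventually.of_forall fun x => IsPath.density_nonneg hW0 x)] at h1
  exact (ENNReal.ofReal_le_ofReal_iff (integral_nonneg fun x => IsPath.density_nonneg hW0 x)).1 h1

end FourthOrder

end

/-! ### Conclusion: equation, decay of derivatives and vanishing Hamiltonian. -/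

open FourthOrder
theorem theorem1p1 {m : ℕ} (W : Vec m → Vec m → ℝ) (Aminus Aplus Ω : Set (Vec m)) (q : ℝ)
    (hW : ContDiff ℝ 2 (fun p : Vec m × Vec m => W p.1 p.2))
    (hW0 : ∀ u v, 0 ≤ W u v)
    (h1 : HypH1 W Aminus Aplus)
    (h2 : HypH2 W Aminus Aplus Ω)
    (h3 : HypH3 W)
    (hq : AdmissibleRadius Aminus Aplus Ω q) :
    ∃ ubar ∈ connectingClass Aminus Aplus q,
      (∀ u ∈ connectingClass Aminus Aplus q, energy W ubar ≤ energy W u) ∧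
      energy W ubar < ⊤ ∧
      ContDiff ℝ 4 ubar ∧
      SolvesEulerLagrange W ubar ∧
      Tendsto (fun x => Metric.infDist (ubar x) Aminus) atBot (𝓝 0) ∧
      Tendsto (fun x => Metric.infDist (ubar x) Aplus) atTop (𝓝 0) ∧
      (∀ k ∈ Finset.Icc 1 3, Tendsto (iteratedDeriv k ubar) atBot (𝓝 0) ∧
        Tendsto (iteratedDeriv k ubar) atTop (𝓝 0)) ∧
      ∀ x : ℝ, hamiltonian W ubar x = 0 := by
  obtain ⟨u, v, w₀, C, B, M, hB, hM, hbp, hmem, hmin, hfin, hminus, hplus⟩ :=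
    exists_minimal_path hW.continuous hW0 h1 h2 h3 hq
  have hpath := hbp.path
  have hcu := hpath.continuous
  have hcv := hpath.continuous_velocity
  obtain ⟨b, w, z, hww, hv, hw, hz⟩ := hpath.exists_acc_eq hW fun φ hφ =>
    hpath.weak_euler_lagrange_of_minimal hW hW0 hbp.integrable
      (hminus.eventually_le_const hq.pos) (hplus.eventually_le_const hq.pos) hmin hφ
  have hgU : Continuous fun x => gradU W (u x) (v x) :=
    (contDiff_gradU hW).continuous.comp (hcu.prodMk hcv)
  have hcw : Continuous w := continuous_iff_continuousAt.2 fun x => (hw x).continuousAt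
  set y : ℝ → Vec m := fun x => hessUV W (u x) (v x) (v x) + hessVV W (u x) (v x) (w x)
    - gradU W (u x) (v x) with hy
  have hyc : Continuous y := (continuous_hess_apply hW hcu hcv hcv hcw).sub hgU
  have hP : ∀ x, HasDerivAt (fun x => ∫ t in (0 : ℝ)..x, gradU W (u t) (v t))
      (gradU W (u x) (v x)) x := fun x => by simpa using hasDerivAt_add_primitive hgU 0 x
  have hzd : ∀ x, HasDerivAt z (y x) x := fun x => by
    rw [funext hz]
    exact ((hasDerivAt_gradV hW (hpath.hasDerivAt x) (hv x)).const_add b).sub (hP x)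
  obtain ⟨hC4, i1, i2, i3, i4⟩ := contDiff_four_of_hasDerivAt hpath.hasDerivAt hv hw hzd hyc
  have hdu : deriv u = v := by rw [← iteratedDeriv_one, i1]
  have hA : IsCompact (Aminus ∪ Aplus) := h1.compact_minus.union h1.compact_plus
  have hAne : (Aminus ∪ Aplus).Nonempty := h1.nonempty_minus.mono subset_union_left
  have hA0 : ∀ a ∈ Aminus ∪ Aplus, W a 0 = 0 := fun a ha => by
    rw [h1.union_eq] at ha; exact ha
  have hv0 := hbp.tendsto_velocity hW0 hB
  have hdist := hbp.tendsto_infDist hW.continuous hW0 hB hM h1.union_eq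
  have hU0 : Tendsto (fun x => gradU W (u x) (v x)) (cocompact ℝ) (𝓝 0) :=
    tendsto_zero_of_tendsto_infDist (contDiff_gradU hW).continuous hA hAne
      (fun a ha => (grad_eq_zero hW hW0 (hA0 a ha)).1) hdist hv0
  have hV0 : Tendsto (fun x => gradV W (u x) (v x)) (cocompact ℝ) (𝓝 0) :=
    tendsto_zero_of_tendsto_infDist (contDiff_gradV hW).continuous hA hAne
      (fun a ha => (grad_eq_zero hW hW0 (hA0 a ha)).2) hdist hv0
  obtain ⟨hw0, hz0⟩ := tendsto_deriv_of_tendsto hv hw hv0 fun ε hε => by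
    have hδ : 0 < ε / 4 := by positivity
    filter_upwards [eventually_cocompact_Icc (Metric.tendsto_nhds.1 hU0 _ hδ) 2,
      eventually_cocompact_Icc (Metric.tendsto_nhds.1 hV0 _ hδ) 2] with x hx1 hx2 t ht
    have e1 : z t - z x = gradV W (u t) (v t) - gradV W (u x) (v x)
        - ∫ s in x..t, gradU W (u s) (v s) := by
      rw [hz t, hz x, ← intervalIntegral.integral_interval_sub_left
        (hgU.intervalIntegrable 0 t) (hgU.intervalIntegrable 0 x)]
      abel
    have e2 : ‖∫ s in x..t, gradU W (u s) (v s)‖ ≤ ε / 4 * |t - x| :=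
      intervalIntegral.norm_integral_le_of_norm_le_const fun s hs => by
        rw [uIoc_of_le ht.1] at hs
        have := hx1 s ⟨hs.1.le, hs.2.trans ht.2⟩
        rw [dist_zero_right] at this
        exact this.le
    have e3 : ε / 4 * |t - x| ≤ ε / 4 * 2 := by
      rw [abs_of_nonneg (by linarith [ht.1])]
      gcongr
      linarith [ht.2]
    have e4 := hx2 t ht
    have e5 := hx2 x ⟨le_rfl, by linarith⟩
    rw [dist_zero_right] at e4 e5
    rw [e1]
    refine (norm_sub_le _ _).trans ((add_le_add (norm_sub_le _ _) e2).trans ?_)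
    linarith
  refine ⟨u, hmem, hmin, hfin, hC4, fun x => ?_, hminus, hplus, fun k hk => ?_, ?_⟩
  · rw [i4, i2, hdu]
    simp only [hy]
    abel
  · rw [← tendsto_sup, ← cocompact_eq_atBot_atTop]
    obtain ⟨hk1, hk3⟩ := Finset.mem_Icc.1 hk
    interval_cases k
    · rwa [i1]
    · rwa [i2]
    · rwa [i3]
  · have hH : hamiltonian W u = fun x => 1 / 2 * ‖w x‖ ^ 2 - W (u x) (v x)
        + inner ℝ (gradV W (u x) (v x)) (v x) - inner ℝ (z x) (v x) := by
      funext x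
      rw [hamiltonian, i2, i3, hdu]
    -- Inserting the integrated equation for `z` cancels the `gradV` term, so the derivative
    -- involves no second derivatives of `W`.
    have hH' : hamiltonian W u = fun x => 1 / 2 * ‖w x‖ ^ 2 - W (u x) (v x)
        + inner ℝ ((∫ t in (0 : ℝ)..x, gradU W (u t) (v t)) - b) (v x) := by
      rw [hH]
      funext x
      rw [hz x, inner_sub_left, inner_sub_left, inner_add_left]
      ring
    have hder : ∀ x, HasDerivAt (hamiltonian W u) 0 x := fun x => by
      rw [hH']
      have d1 := ((hw x).norm_sq).const_mul (1 / 2 : ℝ)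
      have d2 := hasDerivAt_potential hW (hpath.hasDerivAt x) (hv x)
      have d3 := ((hP x).sub_const b).inner ℝ (hv x)
      refine ((d1.sub d2).add d3).congr_deriv ?_
      rw [hz x]
      simp only [inner_add_right, inner_sub_right, real_inner_comm (w x)]
      ring
    have hlim : Tendsto (hamiltonian W u) (cocompact ℝ) (𝓝 0) := by
      rw [hH]
      have l1 := ((hw0.norm.pow 2).const_mul (1 / 2 : ℝ)).sub
        (hbp.tendsto_potential hW.continuous hW0 hM)
      have l2 := (l1.add (hV0.inner hv0)).sub (hz0.inner hv0)
      simpa using l2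
    rw [cocompact_eq_atBot_atTop, tendsto_sup] at hlim
    intro x
    have hconst : ∀ t, hamiltonian W u t = hamiltonian W u x := fun t =>
      is_const_of_deriv_eq_zero (fun s => (hder s).differentiableAt) (fun s => (hder s).deriv) t x
    have : Tendsto (hamiltonian W u) atTop (𝓝 (hamiltonian W u x)) :=
      tendsto_const_nhds.congr fun t => (hconst t).symm
    exact tendsto_nhds_unique this hlim.2
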